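/- **Setting.** Let $n\ge 1$, $d\ge 0$, and let $F(x)=\frac1n\sum_{i=1}^n f_i(x)+g(x)$ on $\mathbb{R}^d$ (Euclidean norm), where each $f_i:\mathbb{R}^d\to\mathbb{R}$ is convex and differentiable with $\|\nabla f_i(x)-\nabla f_i(y)\|\le L_i\|x-y\|$ for all $x,y$ ($L_i>0$), and $g:\mathbb{R}^d\to\mathbb{R}$ is convex, not necessarily smooth or strongly convex. Let $x^\star$ be a minimizer of $F$, let $p=(p_1,\dots,p_n)$ be a probability distribution with all $p_i>0$, and put $\widetilde L=\max_j L_j/(np_j)$. Let $\widetilde x^0\in\mathbb{R}^d$ and $\Delta_F=F(\widetilde x^0)-F(x^\star)$. The oracle complexity is the number of evaluations of component gradients $\nabla f_i(x)$. **Algorithm 1 (ASVRG, Option II)** for a regularizer $h$, with parameters $\eta,\omega,m_1,m,\rho\ge1$ and number of epochs $S$: start with $\widetilde x^0=x^1_0=y^1_0$. For $s=1,\dots,S$: compute $\widetilde\mu=\frac1n\sum_i\nabla f_i(\widetilde x^{s-1})$; for $t=1,\dots,m_s$ draw $i_t\sim p$ independently and set $$v_t=\frac{\nabla f_{i_t}(x^s_{t-1})-\nabla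 f_{i_t}(\widetilde x^{s-1})}{np_{i_t}}+\widetilde\mu,\qquad y^s_t=\arg\min_y\Big\{\langle v_t,y-y^s_{t-1}\rangle+\frac{\omega}{2\eta}\|y-y^s_{t-1}\|^2+h(y)\Big\},\qquad x^s_t=\widetilde x^{s-1}+\omega(y^s_t-\widetilde x^{s-1});$$ then $\widetilde x^s=\frac1{m_s}\sum_{t=1}^{m_s}x^s_t$, $x^{s+1}_0=(1-\omega)\widetilde x^s+\omega y^s_{m_s}$, $y^{s+1}_0=y^s_{m_s}$, $m_{s+1}=\min(\lfloor\rho m_s\rfloor,m)$. **Base method** $\mathcal A(h,\sigma,x)$ for a $\sigma$-strongly convex regularizer $h$: take $m_1=m$; if $m\sigma/\widetilde L\le\frac34$ take $\eta=\frac1{3\widetilde L}$, $\omega=\sqrt{m\sigma/(3\widetilde L)}$, otherwise $\eta=\frac1{4m\sigma}$, $\omega=\frac12$. Run Algorithm 1 from $x$ for $\mathcal S=\big\lceil 2\big(\frac{1-\omega}{\omega}+\frac{\omega}{\eta m\sigma}\big)\big\rceil$ epochs, restart it from the average $\frac1{\mathcal S}\sum_{s=1}^{\mathcal S}\widetilde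 x^s$ for another $\mathcal S$ epochs, and return the average of the snapshots of this second run. **AdaptReg**: set $\sigma_0=\Delta_F/\|\widetilde x^0-x^\star\|^2$, $T=\max\{0,\lceil\log_2(2\Delta_F/\varepsilon)\rceil\}$ ($T=0$ if $\Delta_F=0$) and $\hat x_0=\widetilde x^0$. For $t=0,\dots,T-1$ let $\hat x_{t+1}=\mathcal A\big(g+\frac{\sigma_t}{2}\|\cdot-\widetilde x^0\|^2,\ \sigma_t,\ \hat x_t\big)$ and $\sigma_{t+1}=\sigma_t/2$. Return $\hat x_T$. **Statement.** For all constants $0<a\le b$ there is a constant $C>0$, depending only on $a$ and $b$, such that for all data as above, all integers $m$ with $an\le m\le bn$ (that is, $m=\Theta(n)$), all $\rho\ge1$ and all $\varepsilon>0$, the output satisfies $$\mathbb{E}[F(\hat x_T)]-F(x^\star)\le\varepsilon,$$ and, for every outcome of the random draws, the number of component gradient evaluations is at most $$C\left(n\max\Big\{1,\log\frac{F(\widetilde x^0)-F(x^\star)}{\varepsilon}\Big\}+\frac{\sqrt{n\widetilde L}\,\|\widetilde x^0-x^\star\|}{\sqrt\varepsilon}\right)$$ (where the maximum is read as $1$ if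 $F(\widetilde x^0)=F(x^\star)$). -/

import Mathlib

namespace ASVRG

noncomputable section

/-! ### Randomized first-order oracle programs

A program that may query component gradients `∇ f_i (x)` and draw random indices.
Its only access to the components `f_1, …, f_n` is through `query`. -/

/-- Randomized programs with a component-gradient oracle, with values in `α`:
stop with a value, query the gradient of component `i` at `x`, or draw an index. -/
inductive Prog (n : ℕ) (E α : Type) : Type
  | done (a : α) : Prog n E α
  | query (i : Fin n) (x : E) (k : E → Prog n E α) : Prog n E α
  | sample (k : Fin n → Prog n E α) : Prog n E α

namespace Prog

variable {n : ℕ} {E α β : Type}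

/-- Sequential composition. -/
def andThen : Prog n E α → (α → Prog n E β) → Prog n E β
  | done a, h => h a
  | query i x k, h => query i x (fun v => andThen (k v) h)
  | sample k, h => sample (fun i => andThen (k i) h)

instance : Monad (Prog n E) where
  pure := done
  bind := andThen

/-- Ask the oracle for the gradient of component `i` at `x`. -/
def ask (i : Fin n) (x : E) : Prog n E E := query i x done

/-- Draw a random index. -/
def draw : Prog n E (Fin n) := sample done

/-- Expected value of `φ (output)` when every query `(i, x)` is answered by `O i x` and every
drawn index is an independent sample from the distribution `p` on `{1, …, n}`. -/
def expect (p : Fin n → ℝ) (O : Fin n → E → E) : Prog n E α → (α → ℝ) → ℝ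
  | done a, φ => φ a
  | query i x k, φ => expect p O (k (O i x)) φ
  | sample k, φ => ∑ i, p i * expect p O (k i) φ

/-- Number of oracle queries, in the worst case over the drawn indices. -/
def calls (O : Fin n → E → E) : Prog n E α → ℕ
  | done _ => 0
  | query i x k => 1 + calls O (k (O i x))
  | sample k => Finset.univ.sup fun i => calls O (k i)

end Prog

/-! ### The finite-sum objective -/

variable {n d : ℕ}

/-- The Euclidean space `ℝ^d`. -/
abbrev Vec (d : ℕ) : Type := EuclideanSpace ℝ (Fin d)

/-- `F = (1/n) ∑ f_i + g`. -/
def objective (f : Fin n → Vec d → ℝ) (g : Vec d → ℝ) (x : Vec d) : ℝ :=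
  (1 / (n : ℝ)) * ∑ i, f i x + g x

/-- `L̃ = max_j L_j / (n p_j)`. -/
def weightedL (L p : Fin n → ℝ) : ℝ := ⨆ j, L j / (n * p j)

/-- The component-gradient oracle of `f_1, …, f_n`. -/
def gradOracle (f : Fin n → Vec d → ℝ) (i : Fin n) (x : Vec d) : Vec d := gradient (f i) x

/-- A minimizer of `φ` over the whole space (arbitrary if there is none). -/
def argmin (φ : Vec d → ℝ) : Vec d := Classical.epsilon fun y => ∀ z, φ y ≤ φ z

/-! ### The accelerated proximal SVRG method (Option II) -/

/-- Input parameters: step size `η`, momentum `ω`, first epoch length `m₁`, epoch growth factor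
`ρ`, maximal epoch length `m`, and sampling distribution `p`. -/
structure Params (n : ℕ) where
  η : ℝ
  ω : ℝ
  m₁ : ℕ
  ρ : ℝ
  m : ℕ
  p : Fin n → ℝ

/-- State of the inner loop: `x_t`, `y_t`, and `x_1 + ⋯ + x_t`. -/
structure InnerState (d : ℕ) where
  x : Vec d
  y : Vec d
  xSum : Vec d

/-- The full gradient `(1/n) ∑ ∇ f_i (x)`, computed with `n` queries. -/
def fullGrad (x : Vec d) : Prog n (Vec d) (Vec d) := do
  let s ← (List.finRange n).foldlM (fun (acc : Vec d) i => do
    let v ← Prog.ask i x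
    pure (acc + v)) 0
  pure ((1 / (n : ℝ)) • s)

/-- One stochastic iteration in an epoch with snapshot `snap` and full gradient `μ` there. -/
def innerStep (P : Params n) (g : Vec d → ℝ) (snap μ : Vec d) (st : InnerState d) :
    Prog n (Vec d) (InnerState d) := do
  let i ← Prog.draw
  let a ← Prog.ask i st.x
  let b ← Prog.ask i snap
  let v := (1 / (n * P.p i)) • (a - b) + μ
  let y' := argmin fun y =>
    inner ℝ v (y - st.y) + P.ω / (2 * P.η) * ‖y - st.y‖ ^ 2 + g y
  let x' := snap + P.ω • (y' - snap)
  pure ⟨x', y', st.xSum + x'⟩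

/-- `k` stochastic iterations. -/
def innerLoop (P : Params n) (g : Vec d → ℝ) (snap μ : Vec d) :
    ℕ → InnerState d → Prog n (Vec d) (InnerState d)
  | 0, st => pure st
  | k + 1, st => do
    let st' ← innerStep P g snap μ st
    innerLoop P g snap μ k st'

/-- State between epochs: the snapshot `x̃^s`, the starting points `x^{s+1}_0` and `y^{s+1}_0`,
the next epoch length `m_{s+1}`, and the sum `x̃^1 + ⋯ + x̃^s` of the snapshots so far. -/
structure EpochState (d : ℕ) where
  snap : Vec d
  x : Vec d
  y : Vec d
  len : ℕ
  snapSum : Vec d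

/-- One epoch. -/
def epoch (P : Params n) (g : Vec d → ℝ) (st : EpochState d) :
    Prog n (Vec d) (EpochState d) := do
  let μ ← fullGrad st.snap
  let r ← innerLoop P g st.snap μ st.len ⟨st.x, st.y, 0⟩
  let snap' := (1 / (st.len : ℝ)) • r.xSum
  pure ⟨snap', (1 - P.ω) • snap' + P.ω • r.y, r.y, min ⌊P.ρ * st.len⌋₊ P.m,
    st.snapSum + snap'⟩

/-- `S` epochs. -/
def epochs (P : Params n) (g : Vec d → ℝ) : ℕ → EpochState d → Prog n (Vec d) (EpochState d)
  | 0, st => pure st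
  | S + 1, st => do
    let st' ← epoch P g st
    epochs P g S st'

/-- The method with Option II, run for `S` epochs from `x̃^0 = x₀`. -/
def asvrg (P : Params n) (g : Vec d → ℝ) (S : ℕ) (x₀ : Vec d) :
    Prog n (Vec d) (EpochState d) :=
  epochs P g S ⟨x₀, x₀, x₀, P.m₁, 0⟩

/-- The method restarted `R` times, every `S` epochs, each time from the average
`(1/S) ∑ x̃^s` of the snapshots of the `S` epochs before. -/
def restartedAsvrg (P : Params n) (g : Vec d → ℝ) (S : ℕ) :
    ℕ → Vec d → Prog n (Vec d) (Vec d)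
  | 0, x => pure x
  | R + 1, x => do
    let st ← asvrg P g S x
    restartedAsvrg P g S R ((1 / (S : ℝ)) • st.snapSum)

/-! ### Parameter choices for a `σ`-strongly convex regularizer -/

/-- Step size `η`. -/
def stepSize (Lt : ℝ) (m : ℕ) (σ : ℝ) : ℝ :=
  if m * σ / Lt ≤ 3 / 4 then 1 / (3 * Lt) else 1 / (4 * m * σ)

/-- Momentum weight `ω`. -/
def momentum (Lt : ℝ) (m : ℕ) (σ : ℝ) : ℝ :=
  if m * σ / Lt ≤ 3 / 4 then √(m * σ / (3 * Lt)) else 1 / 2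

/-- Number of epochs between restarts, `2 ((1 - ω) / ω + ω / (η m σ))` rounded up. -/
def restartPeriod (η ω : ℝ) (m : ℕ) (σ : ℝ) : ℕ :=
  ⌈2 * ((1 - ω) / ω + ω / (η * m * σ))⌉₊

/-- The base method for a `σ`-strongly convex regularizer `g`: all epochs have length `m`, with
two rounds of `restartPeriod` epochs (each halves the expected gap, so that together
they give the factor `1/4` that the reduction below asks of its base method). -/
def baseMethod (L p : Fin n → ℝ) (m : ℕ) (ρ : ℝ) (g : Vec d → ℝ) (σ : ℝ) (x : Vec d) :
    Prog n (Vec d) (Vec d) :=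
  let η := stepSize (weightedL L p) m σ
  let ω := momentum (weightedL L p) m σ
  restartedAsvrg ⟨η, ω, m, ρ, m, p⟩ g (restartPeriod η ω m σ) 2 x

/-! ### Adaptive regularization -/

/-- The adaptive regularization reduction with base method `A`, centre `x₀`, and `T` stages:
in each stage `A` is applied, from the current point, to the regularizer
`g + (σ/2) ‖· - x₀‖²`, and then `σ` is halved. -/
def adaptReg (A : (Vec d → ℝ) → ℝ → Vec d → Prog n (Vec d) (Vec d)) (g : Vec d → ℝ)
    (x₀ : Vec d) : ℕ → ℝ → Vec d → Prog n (Vec d) (Vec d)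
  | 0, _, x => pure x
  | T + 1, σ, x => do
    let x' ← A (fun z => g z + σ / 2 * ‖z - x₀‖ ^ 2) σ x
    adaptReg A g x₀ T (σ / 2) x'

/-- Adaptive regularization applied to the restarted method, started at `x₀`, with
`σ₀ = Δ / D²` and `T = ⌈log₂ (2 Δ / ε)⌉` stages (none if `2 Δ ≤ ε`). -/
def adaptRegAsvrg (L p : Fin n → ℝ) (m : ℕ) (ρ : ℝ) (g : Vec d → ℝ) (x₀ : Vec d)
    (Δ D ε : ℝ) : Prog n (Vec d) (Vec d) :=
  adaptReg (baseMethod L p m ρ) g x₀ ⌈Real.logb 2 (2 * Δ / ε)⌉₊ (Δ / D ^ 2) x₀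

end

end ASVRG

namespace ASVRG
/-! ### Convex analysis -/

section Convex

open Filter Topology

variable {E : Type*} [NormedAddCommGroup E] [InnerProductSpace ℝ E]

/-! The estimator `estimator` is unbiased, and cocoercivity of the component gradients bounds its
variance by `2 L̃` times the Bregman divergence from the current point to the snapshot
(`variance_le`). The descent lemma, the three-point inequality of the proximal step and Young's
inequality then produce a variance term which `Admissible` lets the `(1 - ω)`-weighted Bregman term
absorb. Hence (`expect_innerStep_le`) one iteration turns `(1 - ω) gap(snap) + ω²/(2η) ‖z - y‖²`
into at least the expected `gap(x') + ω²/(2η) ‖z - y'‖²`.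

Summing over an epoch and then over epochs telescopes the distances; convexity moves the gaps to
averages. With `σ`-quadratic growth at the minimizer, the initial distance is itself bounded by the
gap, so `S` epochs contract by `((1 - ω)/ω + ω/(ηmσ))/S` (`expect_asvrg_le`). The restart period
makes this `1/2`, and two runs give `1/4`.

For adaptive regularization, halving `σ` raises the regularized gap by at most `σ/4 ‖x₀ - xs‖²`. A
quarter of the old gap plus this drift decays like `2^{-T}` (`expect_adaptReg_le`). A stage costs
`O((n + m)(1 + √(L̃/(mσ))))` queries; the constant parts add up to a logarithm and the roots to a
geometric series dominated by its end (`calls_adaptReg_le`). -/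

/-- A convex function plus a positive multiple of a squared distance attains its minimum. -/
theorem exists_isMin_add_sq [FiniteDimensional ℝ E] {u : E → ℝ} (hu : ConvexOn ℝ Set.univ u)
    {c : ℝ} (hc : 0 < c) (y₀ : E) :
    ∃ y, ∀ z, u y + c / 2 * ‖y - y₀‖ ^ 2 ≤ u z + c / 2 * ‖z - y₀‖ ^ 2 := by
  have hcont : Continuous u := hu.locallyLipschitz.continuous
  -- Convexity propagates the minimum over the unit ball outwards: `u` falls at most linearly along
  -- rays from `y₀`, so the quadratic wins far away.
  obtain ⟨w, -, hw⟩ := (isCompact_closedBall y₀ (1 : ℝ)).exists_isMinOn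
    (Metric.nonempty_closedBall.2 zero_le_one) hcont.continuousOn
  refine Continuous.exists_forall_le' (by fun_prop) y₀ ?_
  have hlim := tendsto_dist_right_cocompact_atTop y₀
  filter_upwards [hlim.eventually_ge_atTop 1,
    hlim.eventually_ge_atTop ((u y₀ - u w) / (c / 2))] with y hy1 hy2
  rw [dist_eq_norm] at hy1 hy2
  set r := ‖y - y₀‖ with hr
  have hr0 : 0 < r := by linarith
  have hmem : y₀ + r⁻¹ • (y - y₀) ∈ Metric.closedBall y₀ (1 : ℝ) := by
    rw [Metric.mem_closedBall, dist_eq_norm, add_sub_cancel_left, norm_smul, ← hr,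
      Real.norm_of_nonneg (by positivity), inv_mul_cancel₀ hr0.ne']
  have h1 : u w ≤ u (y₀ + r⁻¹ • (y - y₀)) := hw hmem
  have hri : r⁻¹ ≤ 1 := inv_le_one_of_one_le₀ hy1
  have h2 := hu.2 (Set.mem_univ y₀) (Set.mem_univ y)
    (show 0 ≤ 1 - r⁻¹ by linarith) (show 0 ≤ r⁻¹ by positivity) (by ring)
  have he : (1 - r⁻¹) • y₀ + r⁻¹ • y = y₀ + r⁻¹ • (y - y₀) := by module
  rw [he] at h2
  simp only [smul_eq_mul] at h2
  rw [div_le_iff₀ (by positivity)] at hy2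
  have h3 : u w - u y₀ ≤ r⁻¹ * (u y - u y₀) := by linarith
  have h4 : r * (u w - u y₀) ≤ u y - u y₀ := by
    calc r * (u w - u y₀) ≤ r * (r⁻¹ * (u y - u y₀)) := by gcongr
      _ = _ := by field_simp
  simp only [sub_self, norm_zero]
  nlinarith

/-- The three-point inequality for a minimizer of a convex function plus a squared distance. -/
theorem three_point {u : E → ℝ} (hu : ConvexOn ℝ Set.univ u) {c : ℝ} {y₀ y : E}
    (hy : ∀ z, u y + c / 2 * ‖y - y₀‖ ^ 2 ≤ u z + c / 2 * ‖z - y₀‖ ^ 2) (z : E) :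
    u y + c / 2 * ‖y - y₀‖ ^ 2 + c / 2 * ‖z - y‖ ^ 2 ≤ u z + c / 2 * ‖z - y₀‖ ^ 2 := by
  -- First-order optimality without differentiating `u`: compare `y` with a point of the segment
  -- towards `z`, divide by `t`, and let `t` tend to `0`.
  have key : ∀ t : ℝ, 0 < t → t ≤ 1 →
      0 ≤ (u z - u y + c * inner ℝ (y - y₀) (z - y)) + t * (c / 2 * ‖z - y‖ ^ 2) := by
    intro t ht0 ht1
    have h1 := hy ((1 - t) • y + t • z)
    have h2 := hu.2 (Set.mem_univ y) (Set.mem_univ z)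
      (show 0 ≤ 1 - t by linarith) ht0.le (by ring)
    have he : (1 - t) • y + t • z - y₀ = (y - y₀) + t • (z - y) := by module
    rw [he, norm_add_sq_real, inner_smul_right, norm_smul, Real.norm_of_nonneg ht0.le] at h1
    simp only [smul_eq_mul] at h2
    refine nonneg_of_mul_nonneg_right ?_ ht0
    nlinarith
  have hlim : Tendsto (fun t : ℝ => (u z - u y + c * inner ℝ (y - y₀) (z - y)) +
      t * (c / 2 * ‖z - y‖ ^ 2)) (𝓝[>] 0)
      (𝓝 ((u z - u y + c * inner ℝ (y - y₀) (z - y)) + 0 * (c / 2 * ‖z - y‖ ^ 2))) := by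
    refine (Continuous.tendsto ?_ 0).mono_left nhdsWithin_le_nhds
    fun_prop
  have h0 := ge_of_tendsto hlim (by
    filter_upwards [Ioc_mem_nhdsGT (zero_lt_one (α := ℝ))] with t ht using key t ht.1 ht.2)
  have he : z - y₀ = (y - y₀) + (z - y) := by abel
  rw [he, norm_add_sq_real]
  linarith

variable [CompleteSpace E]

theorem hasDerivAt_comp_line {f : E → ℝ} (hf : Differentiable ℝ f) (x v : E) (t : ℝ) :
    HasDerivAt (fun s : ℝ => f (x + s • v)) (inner ℝ (gradient f (x + t • v)) v) t := by
  have h1 : HasDerivAt (fun s : ℝ => x + s • v) v t := by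
    simpa using ((hasDerivAt_id t).smul_const v).const_add x
  have h2 := (hf (x + t • v)).hasGradientAt.hasFDerivAt.comp_hasDerivAt t h1
  simpa [Function.comp_def] using h2

/-- A differentiable convex function lies above its tangents. -/
theorem convex_first_order {f : E → ℝ} (hc : ConvexOn ℝ Set.univ f) (hf : Differentiable ℝ f)
    (x y : E) : f x + inner ℝ (gradient f x) (y - x) ≤ f y := by
  have hline : ConvexOn ℝ Set.univ (fun s : ℝ => f (x + s • (y - x))) := by
    have h := hc.comp_affineMap (AffineMap.lineMap x y : ℝ →ᵃ[ℝ] E)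
    have he : (f ∘ (AffineMap.lineMap x y : ℝ →ᵃ[ℝ] E)) = fun s : ℝ => f (x + s • (y - x)) := by
      funext s
      simp [AffineMap.lineMap_apply, add_comm]
    rw [← he]
    simpa using h
  have h := hline.le_slope_of_hasDerivAt (Set.mem_univ 0) (Set.mem_univ 1) one_pos
    (hasDerivAt_comp_line hf x (y - x) 0)
  simp only [slope_def_field, zero_smul, add_zero, one_smul, sub_zero, div_one,
    add_sub_cancel] at h
  linarith

/-- The descent lemma. -/
theorem descent {f : E → ℝ} (hf : Differentiable ℝ f) {L : ℝ}
    (hL : ∀ x y, ‖gradient f x - gradient f y‖ ≤ L * ‖x - y‖) (x y : E) :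
    f y ≤ f x + inner ℝ (gradient f x) (y - x) + L / 2 * ‖y - x‖ ^ 2 := by
  set v := y - x with hv
  have hd : ∀ t : ℝ, HasDerivAt
      (fun s : ℝ => f (x + s • v) - (s * inner ℝ (gradient f x) v + s ^ 2 * (L / 2 * ‖v‖ ^ 2)))
      (inner ℝ (gradient f (x + t • v)) v -
        (1 * inner ℝ (gradient f x) v + (2 * t) * (L / 2 * ‖v‖ ^ 2))) t := by
    intro t
    refine (hasDerivAt_comp_line hf x v t).sub (((hasDerivAt_id t).mul_const _).add ?_)
    simpa using (hasDerivAt_pow 2 t).mul_const (L / 2 * ‖v‖ ^ 2)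
  have hanti := antitoneOn_of_deriv_nonpos (convex_Icc (0 : ℝ) 1)
    (fun t _ => (hd t).continuousAt.continuousWithinAt)
    (fun t _ => (hd t).differentiableAt.differentiableWithinAt) (by
      intro t ht
      rw [interior_Icc] at ht
      rw [(hd t).deriv]
      have h1 := real_inner_le_norm (gradient f (x + t • v) - gradient f x) v
      have h2 := hL (x + t • v) x
      rw [add_sub_cancel_left, norm_smul, Real.norm_of_nonneg ht.1.le] at h2
      rw [inner_sub_left] at h1
      nlinarith [norm_nonneg v])
  have h := hanti (Set.left_mem_Icc.2 zero_le_one) (Set.right_mem_Icc.2 zero_le_one) zero_le_one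
  simp only [one_smul, zero_smul, add_zero, hv, add_sub_cancel] at h
  rw [← hv] at h
  linarith

/-- Gradients of smooth convex functions are bounded by the Bregman divergence. -/
theorem norm_gradient_sub_sq_le {f : E → ℝ} (hc : ConvexOn ℝ Set.univ f)
    (hf : Differentiable ℝ f) {L : ℝ} (hL0 : 0 < L)
    (hL : ∀ x y, ‖gradient f x - gradient f y‖ ≤ L * ‖x - y‖) (x y : E) :
    ‖gradient f x - gradient f y‖ ^ 2 ≤
      2 * L * (f y - f x - inner ℝ (gradient f x) (y - x)) := by
  set δ := gradient f x - gradient f y with hδ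
  -- The test point is a gradient step of length `1/L` from `y` for `f` minus its linear part at
  -- `x`, whose gradient at `y` is `-δ`.
  have h1 := convex_first_order hc hf x (y + L⁻¹ • δ)
  have h2 := descent hf hL y (y + L⁻¹ • δ)
  have he : y + L⁻¹ • δ - x = (y - x) + L⁻¹ • δ := by abel
  rw [he, inner_add_right, inner_smul_right] at h1
  rw [add_sub_cancel_left, inner_smul_right, norm_smul,
    Real.norm_of_nonneg (by positivity)] at h2
  have h3 : inner ℝ (gradient f x) δ - inner ℝ (gradient f y) δ = ‖δ‖ ^ 2 := by
    rw [← inner_sub_left, ← hδ, real_inner_self_eq_norm_sq]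
  have h4 : L⁻¹ * ‖δ‖ ^ 2 - L / 2 * (L⁻¹ * ‖δ‖) ^ 2 ≤
      f y - f x - inner ℝ (gradient f x) (y - x) := by
    rw [← h3]
    linarith
  have h5 : ‖δ‖ ^ 2 = 2 * L * (L⁻¹ * ‖δ‖ ^ 2 - L / 2 * (L⁻¹ * ‖δ‖) ^ 2) := by
    field_simp
    ring
  rw [h5]
  gcongr

end Convex

/-! ### Calculus of oracle programs -/

namespace Prog

variable {n : ℕ} {E α β : Type} {p : Fin n → ℝ} {O : Fin n → E → E}

/-- Every possible output satisfies `Q`. -/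
def Post (O : Fin n → E → E) (Q : α → Prop) : Prog n E α → Prop
  | done a => Q a
  | query i x k => Post O Q (k (O i x))
  | sample k => ∀ i, Post O Q (k i)

theorem post_bind {Q : α → Prop} {R : β → Prop} {P : Prog n E α} {h : α → Prog n E β}
    (hP : Post O Q P) (hh : ∀ a, Q a → Post O R (h a)) : Post O R (P >>= h) := by
  induction P with
  | done a => exact hh a hP
  | query i x k ih => exact ih _ hP
  | sample k ih => exact fun i => ih i (hP i)

theorem post_true (P : Prog n E α) : Post O (fun _ => True) P := by
  induction P with
  | done a => trivial
  | query i x k ih => exact ih _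
  | sample k ih => exact fun i => ih i

@[simp] theorem expect_pure (a : α) (φ : α → ℝ) :
    expect p O (pure a : Prog n E α) φ = φ a := rfl

theorem expect_bind (P : Prog n E α) (h : α → Prog n E β) (φ : β → ℝ) :
    expect p O (P >>= h) φ = expect p O P fun a => expect p O (h a) φ := by
  induction P with
  | done a => rfl
  | query i x k ih => exact ih _
  | sample k ih => exact Finset.sum_congr rfl fun i _ => congrArg (p i * ·) (ih i)

/-- Comparing only on outputs that satisfy `Q` is what lets loop invariants enter the expectation
estimates. -/
theorem expect_mono (hp : ∀ i, 0 ≤ p i) {Q : α → Prop} {P : Prog n E α} (hP : Post O Q P)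
    {φ ψ : α → ℝ} (h : ∀ a, Q a → φ a ≤ ψ a) : expect p O P φ ≤ expect p O P ψ := by
  induction P with
  | done a => exact h a hP
  | query i x k ih => exact ih _ hP
  | sample k ih =>
    exact Finset.sum_le_sum fun i _ => mul_le_mul_of_nonneg_left (ih i (hP i)) (hp i)

theorem expect_mul_add (hp : ∑ i, p i = 1) (P : Prog n E α) (φ : α → ℝ) (a b : ℝ) :
    expect p O P (fun x => a * φ x + b) = a * expect p O P φ + b := by
  induction P with
  | done x => rfl
  | query i x k ih => exact ih _
  | sample k ih =>
    simp only [expect, ih, mul_add, Finset.sum_add_distrib, ← Finset.sum_mul, hp, one_mul,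
      Finset.mul_sum]
    congr 1
    exact Finset.sum_congr rfl fun i _ => by ring

theorem calls_bind_le {Q : α → Prop} {P : Prog n E α} (hP : Post O Q P) {h : α → Prog n E β}
    {B : ℕ} (hB : ∀ a, Q a → calls O (h a) ≤ B) : calls O (P >>= h) ≤ calls O P + B := by
  induction P with
  | done a => exact (hB a hP).trans (Nat.le_add_left _ _)
  | query i x k ih =>
    have := ih _ hP
    change 1 + calls O (k (O i x) >>= h) ≤ 1 + calls O (k (O i x)) + B
    omega
  | sample k ih =>
    refine Finset.sup_le fun i _ => (ih i (hP i)).trans ?_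
    exact Nat.add_le_add_right (Finset.le_sup (f := fun i => calls O (k i)) (Finset.mem_univ i)) B

end Prog

/-! ### The full-gradient subroutine -/

section FullGrad

variable {n d : ℕ} {p : Fin n → ℝ} {O : Fin n → Vec d → Vec d}

theorem foldlM_ask (x : Vec d) (l : List (Fin n)) (acc : Vec d) :
    (∀ φ, Prog.expect p O (l.foldlM (fun (acc : Vec d) i => do
      let v ← Prog.ask i x
      pure (acc + v)) acc) φ = φ (acc + (l.map fun i => O i x).sum)) ∧
    Prog.calls O (l.foldlM (fun (acc : Vec d) i => do
      let v ← Prog.ask i x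
      pure (acc + v)) acc) ≤ l.length := by
  induction l generalizing acc with
  | nil => exact ⟨fun φ => by simp, le_rfl⟩
  | cons i l ih =>
    obtain ⟨h1, h2⟩ := ih (acc + O i x)
    rw [List.foldlM_cons]
    constructor
    · intro φ
      rw [List.map_cons, List.sum_cons, ← add_assoc, ← h1 φ]
      rfl
    · rw [List.length_cons, add_comm]
      exact Nat.add_le_add_left h2 1

theorem expect_fullGrad (x : Vec d) (φ : Vec d → ℝ) :
    Prog.expect p O (fullGrad x) φ = φ ((1 / (n : ℝ)) • ∑ i, O i x) := by
  rw [fullGrad, Prog.expect_bind, (foldlM_ask x _ 0).1]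
  rw [zero_add, ← List.ofFn_eq_map, List.sum_ofFn]
  rfl

theorem calls_fullGrad (x : Vec d) : Prog.calls O (fullGrad (n := n) x) ≤ n := by
  have h := (foldlM_ask (p := 0) (O := O) x (List.finRange n) 0).2
  rw [List.length_finRange] at h
  exact (Prog.calls_bind_le (Prog.post_true _) (B := 0) fun _ _ => le_rfl).trans h

end FullGrad

/-! ### One epoch of the method -/

section Analysis

variable {n d : ℕ}

/-- The assumptions on the components and on the sampling distribution. -/
structure SmoothFiniteSum (f : Fin n → Vec d → ℝ) (L p : Fin n → ℝ) : Prop where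
  pos : 0 < n
  convex : ∀ i, ConvexOn ℝ Set.univ (f i)
  diff : ∀ i, Differentiable ℝ (f i)
  L_pos : ∀ i, 0 < L i
  lip : ∀ i x y, ‖gradient (f i) x - gradient (f i) y‖ ≤ L i * ‖x - y‖
  p_pos : ∀ i, 0 < p i
  p_sum : ∑ i, p i = 1

/-- The gradient of the smooth part of the objective. -/
noncomputable def meanGrad (f : Fin n → Vec d → ℝ) (x : Vec d) : Vec d :=
  (1 / (n : ℝ)) • ∑ i, gradient (f i) x

/-- The variance-reduced gradient estimator. -/
noncomputable def estimator (f : Fin n → Vec d → ℝ) (p : Fin n → ℝ) (snap x : Vec d)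
    (i : Fin n) : Vec d :=
  (1 / (n * p i)) • (gradient (f i) x - gradient (f i) snap) + meanGrad f snap

/-- The Bregman divergence of the smooth part of the objective. -/
noncomputable def bregman (f : Fin n → Vec d → ℝ) (y x : Vec d) : ℝ :=
  objective f 0 y - objective f 0 x - inner ℝ (meanGrad f x) (y - x)

theorem objective_eq (f : Fin n → Vec d → ℝ) (h : Vec d → ℝ) (x : Vec d) :
    objective f h x = objective f 0 x + h x := by
  simp [objective]

theorem bregman_eq (f : Fin n → Vec d → ℝ) (y x : Vec d) :
    bregman f y x =
      (1 / (n : ℝ)) * ∑ i, (f i y - f i x - inner ℝ (gradient (f i) x) (y - x)) := by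
  simp only [bregman, objective, meanGrad, Pi.zero_apply, add_zero, inner_smul_left, sum_inner,
    Finset.sum_sub_distrib, mul_sub]
  simp

/-- Variance is second moment minus squared mean. -/
theorem sum_mul_norm_sub_sq_le {ι E : Type*} [Fintype ι] [NormedAddCommGroup E]
    [InnerProductSpace ℝ E] {p : ι → ℝ} (hp : ∑ i, p i = 1) {X : ι → E} {μ : E}
    (hμ : ∑ i, p i • X i = μ) : ∑ i, p i * ‖X i - μ‖ ^ 2 ≤ ∑ i, p i * ‖X i‖ ^ 2 := by
  have h1 : ∑ i, p i * inner ℝ (X i) μ = ‖μ‖ ^ 2 := by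
    rw [← real_inner_self_eq_norm_sq]
    nth_rewrite 2 [← hμ]
    rw [sum_inner]
    exact Finset.sum_congr rfl fun i _ => by rw [real_inner_smul_left]
  have h2 : ∑ i, p i * ‖X i - μ‖ ^ 2 =
      ∑ i, p i * ‖X i‖ ^ 2 - 2 * ∑ i, p i * inner ℝ (X i) μ + (∑ i, p i) * ‖μ‖ ^ 2 := by
    rw [Finset.mul_sum, Finset.sum_mul, ← Finset.sum_sub_distrib, ← Finset.sum_add_distrib]
    exact Finset.sum_congr rfl fun i _ => by rw [norm_sub_sq_real]; ring
  rw [h2, h1, hp]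
  nlinarith [sq_nonneg ‖μ‖]

namespace SmoothFiniteSum

variable {f : Fin n → Vec d → ℝ} {L p : Fin n → ℝ} (H : SmoothFiniteSum f L p)
include H

theorem cast_pos : (0 : ℝ) < n := Nat.cast_pos.2 H.pos

theorem le_weightedL (i : Fin n) : L i ≤ n * p i * weightedL L p := by
  have h : L i / (n * p i) ≤ weightedL L p :=
    le_ciSup (f := fun j => L j / (n * p j)) (Set.finite_range _).bddAbove i
  have := mul_pos H.cast_pos (H.p_pos i)
  rwa [div_le_iff₀' this] at h

theorem weightedL_pos : 0 < weightedL L p := by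
  have i : Fin n := ⟨0, H.pos⟩
  exact pos_of_mul_pos_right ((H.L_pos i).trans_le (H.le_weightedL i))
    (mul_pos H.cast_pos (H.p_pos i)).le

theorem convexOn_objective {h : Vec d → ℝ} (hh : ConvexOn ℝ Set.univ h) :
    ConvexOn ℝ Set.univ (objective f h) := by
  have hs : ConvexOn ℝ Set.univ (fun x => ∑ i, f i x) := by
    have := Finset.sum_induction (s := Finset.univ) f (ConvexOn ℝ Set.univ)
      (fun _ _ h1 h2 => h1.add h2) (convexOn_const 0 convex_univ) (fun i _ => H.convex i)
    simpa [Finset.sum_fn] using this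
  exact (hs.smul (c := 1 / (n : ℝ)) (by positivity)).add hh

theorem bregman_nonneg (y x : Vec d) : 0 ≤ bregman f y x := by
  rw [bregman_eq]
  refine mul_nonneg (by positivity) (Finset.sum_nonneg fun i _ => ?_)
  linarith [convex_first_order (H.convex i) (H.diff i) x y]

/-- The averaged function is `L̃`-smooth because `L i ≤ n p_i L̃` and the `p_i` sum to `1`. -/
theorem bregman_le (y x : Vec d) : bregman f y x ≤ weightedL L p / 2 * ‖y - x‖ ^ 2 := by
  have hn := H.cast_pos
  rw [bregman_eq]
  calc (1 / (n : ℝ)) * ∑ i, (f i y - f i x - inner ℝ (gradient (f i) x) (y - x))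
      ≤ (1 / (n : ℝ)) * ∑ i, n * p i * weightedL L p / 2 * ‖y - x‖ ^ 2 := by
        gcongr with i
        have h1 := descent (H.diff i) (H.lip i) x y
        have h2 : L i / 2 * ‖y - x‖ ^ 2 ≤ n * p i * weightedL L p / 2 * ‖y - x‖ ^ 2 := by
          gcongr
          exact H.le_weightedL i
        linarith
    _ = (∑ i, p i) * (weightedL L p / 2 * ‖y - x‖ ^ 2) := by
        rw [Finset.mul_sum, Finset.sum_mul]
        refine Finset.sum_congr rfl fun i _ => ?_
        field_simp
    _ = _ := by rw [H.p_sum, one_mul]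

theorem sum_estimator (snap x : Vec d) :
    ∑ i, p i • estimator f p snap x i = meanGrad f x := by
  have hn := H.cast_pos
  have h1 : ∀ i, p i • estimator f p snap x i =
      (1 / (n : ℝ)) • (gradient (f i) x - gradient (f i) snap) + p i • meanGrad f snap := by
    intro i
    have := H.p_pos i
    rw [estimator, smul_add, smul_smul]
    congr 2
    field_simp
  rw [Finset.sum_congr rfl fun i _ => h1 i, Finset.sum_add_distrib, ← Finset.smul_sum,
    ← Finset.sum_smul, H.p_sum, Finset.sum_sub_distrib]
  simp only [meanGrad]
  module

/-- The variance bound for the variance-reduced estimator. -/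
theorem variance_le (snap x : Vec d) :
    ∑ i, p i * ‖estimator f p snap x i - meanGrad f x‖ ^ 2 ≤
      2 * weightedL L p * bregman f snap x := by
  have hn := H.cast_pos
  -- Without the full gradient at the snapshot, only the importance-weighted difference remains, and
  -- its second moment is controlled by cocoercivity.
  have h1 := sum_mul_norm_sub_sq_le H.p_sum
    (X := fun i => estimator f p snap x i - meanGrad f snap)
    (μ := meanGrad f x - meanGrad f snap) (by
      simp only [smul_sub, Finset.sum_sub_distrib, H.sum_estimator, ← Finset.sum_smul, H.p_sum,
        one_smul])
  simp only [sub_sub_sub_cancel_right] at h1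
  refine h1.trans ?_
  rw [bregman_eq, Finset.mul_sum, Finset.mul_sum]
  refine Finset.sum_le_sum fun i _ => ?_
  have hp := H.p_pos i
  have hL := H.le_weightedL i
  have h2 := norm_gradient_sub_sq_le (H.convex i) (H.diff i) (H.L_pos i) (H.lip i) x snap
  have h3 := convex_first_order (H.convex i) (H.diff i) x snap
  rw [estimator, add_sub_cancel_right, norm_smul, mul_pow, Real.norm_of_nonneg (by positivity)]
  set B := f i snap - f i x - inner ℝ (gradient (f i) x) (snap - x) with hB
  have hB0 : 0 ≤ B := by linarith
  calc p i * ((1 / (n * p i)) ^ 2 * ‖gradient (f i) x - gradient (f i) snap‖ ^ 2)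
      ≤ p i * ((1 / (n * p i)) ^ 2 * (2 * (n * p i * weightedL L p) * B)) := by
        gcongr
        refine h2.trans ?_
        gcongr
    _ = _ := by field_simp

end SmoothFiniteSum

/-- The outcome of a stochastic iteration in which the index `i` is drawn. -/
noncomputable def stepResult (O : Fin n → Vec d → Vec d) (P : Params n) (h : Vec d → ℝ)
    (snap μ : Vec d) (st : InnerState d) (i : Fin n) : InnerState d :=
  let v := (1 / (n * P.p i)) • (O i st.x - O i snap) + μ
  let y' := argmin fun y =>
    inner ℝ v (y - st.y) + P.ω / (2 * P.η) * ‖y - st.y‖ ^ 2 + h y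
  let x' := snap + P.ω • (y' - snap)
  ⟨x', y', st.xSum + x'⟩

theorem expect_innerStep {p : Fin n → ℝ} {O : Fin n → Vec d → Vec d} (P : Params n)
    (h : Vec d → ℝ) (snap μ : Vec d) (st : InnerState d) (φ : InnerState d → ℝ) :
    Prog.expect p O (innerStep P h snap μ st) φ =
      ∑ i, p i * φ (stepResult O P h snap μ st i) := rfl

theorem post_innerStep {O : Fin n → Vec d → Vec d} (P : Params n)
    (h : Vec d → ℝ) (snap μ : Vec d) (st : InnerState d) :
    Prog.Post O (fun st' => st'.x = snap + P.ω • (st'.y - snap) ∧ st'.xSum = st.xSum + st'.x)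
      (innerStep P h snap μ st) := fun _ => ⟨rfl, rfl⟩

theorem argmin_spec {φ : Vec d → ℝ} (h : ∃ y, ∀ z, φ y ≤ φ z) (z : Vec d) :
    φ (argmin φ) ≤ φ z := Classical.epsilon_spec h z

/-- The conditions on the parameters under which the method is analysed. -/
structure Params.Admissible (P : Params n) (Lt : ℝ) (p : Fin n → ℝ) : Prop where
  p_eq : P.p = p
  η_pos : 0 < P.η
  ω_pos : 0 < P.ω
  ω_lt : P.ω < 1
  le : Lt ≤ (1 - P.ω) * (1 / P.η - Lt)

/-! ### Progress of one stochastic iteration -/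

section Step

variable {f : Fin n → Vec d → ℝ} {L p : Fin n → ℝ} (H : SmoothFiniteSum f L p)
  {P : Params n} (hP : P.Admissible (weightedL L p) p)
  {h : Vec d → ℝ} (hh : ConvexOn ℝ Set.univ h)
include H hP hh

/-- Since `r.x - st.x = ω (r.y - st.y)`, the quadratic errors of smoothness (`L̃`) and of Young's
inequality (`K = 1/η - L̃`) add up to exactly the proximal term, which cancels them. -/
theorem stepResult_le (snap z : Vec d) (st : InnerState d)
    (hst : st.x = snap + P.ω • (st.y - snap)) (i : Fin n) :
    let r := stepResult (gradOracle f) P h snap (meanGrad f snap) st i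
    objective f h r.x + P.ω ^ 2 / (2 * P.η) * ‖z - r.y‖ ^ 2 ≤
      objective f 0 st.x + (1 - P.ω) * h snap + P.ω * h z
        + P.ω * inner ℝ (estimator f p snap st.x i) (z - st.y)
        + P.ω ^ 2 / (2 * P.η) * ‖z - st.y‖ ^ 2
        + 1 / (2 * (1 / P.η - weightedL L p)) *
          ‖estimator f p snap st.x i - meanGrad f st.x‖ ^ 2 := by
  intro r
  have hη := hP.η_pos
  have hω := hP.ω_pos
  have hω1 := hP.ω_lt
  have hL := H.weightedL_pos
  set v := estimator f p snap st.x i with hv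
  set K := 1 / P.η - weightedL L p with hK
  have hK0 : 0 < K := pos_of_mul_pos_right (hL.trans_le hP.le) (by linarith)
  have hry : r.y = argmin fun y =>
      inner ℝ v (y - st.y) + P.ω / (2 * P.η) * ‖y - st.y‖ ^ 2 + h y := by
    rw [hv, estimator, ← hP.p_eq]
    rfl
  have hrx : r.x = snap + P.ω • (r.y - snap) := rfl
  have hconv : ConvexOn ℝ Set.univ (fun y => inner ℝ v (y - st.y) + h y) := by
    refine ConvexOn.add ?_ hh
    have he : (fun y => inner ℝ v (y - st.y)) =
        fun y => innerSL ℝ v y + (-inner ℝ v st.y) := by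
      funext y
      rw [inner_sub_right, innerSL_apply_apply]
      ring
    rw [he]
    exact ((innerSL ℝ v).toLinearMap.convexOn convex_univ).add_const _
  have hcoef : P.ω / P.η / 2 = P.ω / (2 * P.η) := by field_simp
  obtain ⟨y, hy⟩ := exists_isMin_add_sq hconv (c := P.ω / P.η) (by positivity) st.y
  have hmin := argmin_spec (φ := fun y =>
      inner ℝ v (y - st.y) + P.ω / (2 * P.η) * ‖y - st.y‖ ^ 2 + h y)
    ⟨y, fun w => by have := hy w; rw [hcoef] at this; linarith⟩
  rw [← hry] at hmin
  have h3 := three_point hconv (c := P.ω / P.η) (y₀ := st.y) (y := r.y)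
    (fun w => by have := hmin w; rw [hcoef]; linarith) z
  rw [hcoef] at h3
  have hdiff : r.x - st.x = P.ω • (r.y - st.y) := by
    rw [hrx, hst]
    module
  have hdesc := H.bregman_le r.x st.x
  rw [bregman, hdiff, inner_smul_right, norm_smul, Real.norm_of_nonneg hω.le] at hdesc
  have hhconv := hh.2 (Set.mem_univ snap) (Set.mem_univ r.y)
    (show 0 ≤ 1 - P.ω by linarith) hω.le (by ring)
  have he : (1 - P.ω) • snap + P.ω • r.y = r.x := by
    rw [hrx]
    module
  rw [he] at hhconv
  simp only [smul_eq_mul] at hhconv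
  have hyoung : P.ω * inner ℝ (meanGrad f st.x - v) (r.y - st.y) ≤
      K / 2 * (P.ω * ‖r.y - st.y‖) ^ 2 + 1 / (2 * K) * ‖v - meanGrad f st.x‖ ^ 2 := by
    have h1 := real_inner_le_norm (meanGrad f st.x - v) (r.y - st.y)
    rw [norm_sub_rev (meanGrad f st.x) v] at h1
    set A := ‖v - meanGrad f st.x‖
    set B := ‖r.y - st.y‖
    have h2 : P.ω * inner ℝ (meanGrad f st.x - v) (r.y - st.y) ≤ P.ω * (A * B) := by gcongr
    have h4 : K / 2 * (P.ω * B) ^ 2 + 1 / (2 * K) * A ^ 2 - P.ω * (A * B) =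
        1 / (2 * K) * (K * (P.ω * B) - A) ^ 2 := by
      field_simp
      ring
    have h5 : 0 ≤ 1 / (2 * K) * (K * (P.ω * B) - A) ^ 2 := by positivity
    linarith
  rw [inner_sub_left] at hyoung
  have h3' := mul_le_mul_of_nonneg_left h3 hω.le
  have hc : P.ω * (P.ω / (2 * P.η)) = P.ω ^ 2 / (2 * P.η) := by ring
  have hsum : weightedL L p / 2 * (P.ω * ‖r.y - st.y‖) ^ 2 + K / 2 * (P.ω * ‖r.y - st.y‖) ^ 2 =
      P.ω ^ 2 / (2 * P.η) * ‖r.y - st.y‖ ^ 2 := by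
    rw [hK]
    field_simp
    ring
  rw [objective_eq f h, ← hc]
  rw [← hc] at hsum
  linarith

/-- Progress of one stochastic iteration in expectation. -/
theorem expect_innerStep_le (snap z : Vec d) (st : InnerState d)
    (hst : st.x = snap + P.ω • (st.y - snap)) :
    Prog.expect p (gradOracle f) (innerStep P h snap (meanGrad f snap) st) (fun r =>
      (objective f h r.x - objective f h z) + P.ω ^ 2 / (2 * P.η) * ‖z - r.y‖ ^ 2) ≤
    (1 - P.ω) * (objective f h snap - objective f h z)
      + P.ω ^ 2 / (2 * P.η) * ‖z - st.y‖ ^ 2 := by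
  have hη := hP.η_pos
  have hω := hP.ω_pos
  have hω1 := hP.ω_lt
  have hL := H.weightedL_pos
  set K := 1 / P.η - weightedL L p with hK
  have hK0 : 0 < K := pos_of_mul_pos_right (hL.trans_le hP.le) (by linarith)
  rw [expect_innerStep]
  set A := objective f 0 st.x + (1 - P.ω) * h snap + P.ω * h z
      + P.ω ^ 2 / (2 * P.η) * ‖z - st.y‖ ^ 2 - objective f h z with hA
  have h1 : ∑ i, p i * (objective f h (stepResult (gradOracle f) P h snap (meanGrad f snap) st i).x
        - objective f h z + P.ω ^ 2 / (2 * P.η) *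
          ‖z - (stepResult (gradOracle f) P h snap (meanGrad f snap) st i).y‖ ^ 2) ≤
      ∑ i, (p i * A + P.ω * (p i * inner ℝ (estimator f p snap st.x i) (z - st.y))
        + 1 / (2 * K) * (p i * ‖estimator f p snap st.x i - meanGrad f st.x‖ ^ 2)) := by
    refine Finset.sum_le_sum fun i _ => ?_
    have h2 := mul_le_mul_of_nonneg_left (stepResult_le H hP hh snap z st hst i) (H.p_pos i).le
    simp only [← hK] at h2
    rw [hA]
    linarith
  refine h1.trans ?_
  rw [Finset.sum_add_distrib, Finset.sum_add_distrib, ← Finset.sum_mul, ← Finset.mul_sum,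
    ← Finset.mul_sum, H.p_sum, one_mul]
  have h4 : ∑ i, p i * inner ℝ (estimator f p snap st.x i) (z - st.y) =
      inner ℝ (meanGrad f st.x) (z - st.y) := by
    rw [← H.sum_estimator snap st.x, sum_inner]
    exact Finset.sum_congr rfl fun i _ => (real_inner_smul_left _ _ _).symm
  rw [h4]
  -- Admissibility says `L̃ / K ≤ 1 - ω`; this Bregman term then completes the linearization at the
  -- snapshot to `(1 - ω)` times its true value.
  have h5 : 1 / (2 * K) * ∑ i, p i * ‖estimator f p snap st.x i - meanGrad f st.x‖ ^ 2 ≤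
      (1 - P.ω) * bregman f snap st.x := by
    calc _ ≤ 1 / (2 * K) * (2 * weightedL L p * bregman f snap st.x) := by
          gcongr
          exact H.variance_le snap st.x
      _ = weightedL L p / K * bregman f snap st.x := by field_simp
      _ ≤ _ := by
          refine mul_le_mul_of_nonneg_right ?_ (H.bregman_nonneg _ _)
          rw [div_le_iff₀ hK0]
          exact hP.le
  -- The coupling of `x`, `y` and the snapshot splits the direction into one towards `z` and one
  -- towards the snapshot.
  have h6 : P.ω * inner ℝ (meanGrad f st.x) (z - st.y) =
      P.ω * inner ℝ (meanGrad f st.x) (z - st.x)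
        + (1 - P.ω) * inner ℝ (meanGrad f st.x) (snap - st.x) := by
    rw [← inner_smul_right, ← inner_smul_right, ← inner_smul_right, ← inner_add_right]
    congr 1
    rw [hst]
    module
  have h7 := mul_le_mul_of_nonneg_left (H.bregman_nonneg z st.x) hω.le
  rw [bregman] at h5 h7
  rw [h6, hA, objective_eq f h snap, objective_eq f h z]
  linarith

end Step

/-- Adding one point to an average, for a convex function. -/
theorem convex_average_step {Ψ : Vec d → ℝ} (hΨ : ConvexOn ℝ Set.univ Ψ) {j : ℝ} (hj : 0 ≤ j)
    (a b : Vec d) (C : ℝ) :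
    (j + 1) * (Ψ ((1 / (j + 1)) • (j • a + b)) - C) ≤ j * (Ψ a - C) + (Ψ b - C) := by
  have h := hΨ.2 (Set.mem_univ a) (Set.mem_univ b) (show 0 ≤ j / (j + 1) by positivity)
    (show 0 ≤ 1 / (j + 1) by positivity) (by field_simp)
  have he : (j / (j + 1)) • a + (1 / (j + 1)) • b = (1 / (j + 1)) • (j • a + b) := by
    rw [smul_add, smul_smul]
    congr 2
    ring
  rw [he] at h
  simp only [smul_eq_mul] at h
  have h2 := mul_le_mul_of_nonneg_left h (show 0 ≤ j + 1 by positivity)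
  have h3 : (j + 1) * (j / (j + 1) * Ψ a + 1 / (j + 1) * Ψ b) = j * Ψ a + Ψ b := by field_simp
  linarith

end Analysis

/-! ### Loops and restarts -/

section Loops

variable {n d : ℕ}

theorem calls_innerStep_le {O : Fin n → Vec d → Vec d} (P : Params n) (h : Vec d → ℝ)
    (snap μ : Vec d) (st : InnerState d) : Prog.calls O (innerStep P h snap μ st) ≤ 2 :=
  Finset.sup_le fun _ _ => le_rfl

theorem calls_innerLoop_le {O : Fin n → Vec d → Vec d} (P : Params n) (h : Vec d → ℝ)
    (snap μ : Vec d) (k : ℕ) (st : InnerState d) :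
    Prog.calls O (innerLoop P h snap μ k st) ≤ 2 * k := by
  induction k generalizing st with
  | zero => exact le_rfl
  | succ k ih =>
    have h1 := Prog.calls_bind_le (Prog.post_true (O := O) (innerStep P h snap μ st))
      (fun a _ => ih a)
    have h2 := calls_innerStep_le (O := O) P h snap μ st
    refine h1.trans ?_
    omega

/-- The invariant of the states between epochs of length `m`. -/
def EpochState.Inv (P : Params n) (st : EpochState d) : Prop :=
  st.len = P.m ∧ st.x = st.snap + P.ω • (st.y - st.snap)

/-- Starting the next epoch at `(1 - ω) snap' + ω y` restores the coupling, and `ρ ≥ 1` keeps the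
length at its cap. -/
theorem post_epoch {O : Fin n → Vec d → Vec d} {P : Params n} (hρ : 1 ≤ P.ρ) (h : Vec d → ℝ)
    {st : EpochState d} (hst : st.Inv P) :
    Prog.Post O (fun st' => st'.Inv P ∧ st'.snapSum = st.snapSum + st'.snap) (epoch P h st) := by
  refine Prog.post_bind (Prog.post_true _) fun μ _ => ?_
  refine Prog.post_bind (Prog.post_true _) fun r _ => ?_
  refine ⟨⟨?_, ?_⟩, rfl⟩
  · simp only [hst.1]
    refine min_eq_right (Nat.le_floor ?_)
    exact le_mul_of_one_le_left (Nat.cast_nonneg _) hρ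
  · dsimp only
    module

theorem calls_epoch_le {O : Fin n → Vec d → Vec d} (P : Params n) (h : Vec d → ℝ)
    (st : EpochState d) : Prog.calls O (epoch P h st) ≤ n + 2 * st.len := by
  refine (Prog.calls_bind_le (Prog.post_true _) (B := 2 * st.len) fun μ _ => ?_).trans
    (Nat.add_le_add_right (calls_fullGrad _) _)
  refine (Prog.calls_bind_le (Prog.post_true _) (B := 0) fun r _ => le_rfl).trans ?_
  exact calls_innerLoop_le P h _ _ _ _

theorem calls_epochs_le {O : Fin n → Vec d → Vec d} {P : Params n} (hρ : 1 ≤ P.ρ)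
    (h : Vec d → ℝ) (S : ℕ) {st : EpochState d} (hst : st.Inv P) :
    Prog.calls O (epochs P h S st) ≤ S * (n + 2 * P.m) := by
  induction S generalizing st with
  | zero => exact Nat.zero_le _
  | succ S ih =>
    have h1 := Prog.calls_bind_le (post_epoch (O := O) hρ h hst) fun a ha => ih ha.1
    have h2 := calls_epoch_le (O := O) P h st
    rw [hst.1] at h2
    refine h1.trans ?_
    rw [Nat.succ_mul S]
    omega

theorem inv_initial {P : Params n} (hm : P.m₁ = P.m) (x : Vec d) :
    (⟨x, x, x, P.m₁, 0⟩ : EpochState d).Inv P := ⟨hm, by simp⟩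

theorem calls_restartedAsvrg_le {O : Fin n → Vec d → Vec d} {P : Params n} (hρ : 1 ≤ P.ρ)
    (hm : P.m₁ = P.m) (h : Vec d → ℝ) (S R : ℕ) (x : Vec d) :
    Prog.calls O (restartedAsvrg P h S R x) ≤ R * (S * (n + 2 * P.m)) := by
  induction R generalizing x with
  | zero => exact Nat.zero_le _
  | succ R ih =>
    have h1 := Prog.calls_bind_le (Prog.post_true (O := O) (asvrg P h S x))
      fun a _ => ih ((1 / (S : ℝ)) • a.snapSum)
    have h2 : Prog.calls O (asvrg P h S x) ≤ _ :=
      calls_epochs_le (O := O) hρ h S (inv_initial hm x)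
    refine h1.trans ?_
    rw [Nat.succ_mul R]
    omega

variable {f : Fin n → Vec d → ℝ} {L p : Fin n → ℝ} (H : SmoothFiniteSum f L p)
  {P : Params n} (hP : P.Admissible (weightedL L p) p)
  {h : Vec d → ℝ} (hh : ConvexOn ℝ Set.univ h)
include H hP hh

/-- Induction needs points already summed: `w` is the average of `j` of them. The method itself
starts from `j = 0`, where `w` is irrelevant. -/
theorem expect_innerLoop_le (snap z : Vec d) (k : ℕ) {j : ℝ} (hj : 0 ≤ j) (w : Vec d)
    (st : InnerState d) (hst : st.x = snap + P.ω • (st.y - snap)) (hw : st.xSum = j • w) :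
    Prog.expect p (gradOracle f) (innerLoop P h snap (meanGrad f snap) k st) (fun r =>
      (j + k) * (objective f h ((1 / (j + k)) • r.xSum) - objective f h z)
        + P.ω ^ 2 / (2 * P.η) * ‖z - r.y‖ ^ 2) ≤
    j * (objective f h w - objective f h z) + P.ω ^ 2 / (2 * P.η) * ‖z - st.y‖ ^ 2
      + k * ((1 - P.ω) * (objective f h snap - objective f h z)) := by
  have hp0 : ∀ i, 0 ≤ p i := fun i => (H.p_pos i).le
  induction k generalizing j w st with
  | zero =>
    simp only [innerLoop, Prog.expect_pure, hw, Nat.cast_zero, add_zero, zero_mul]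
    rcases hj.eq_or_lt with rfl | hj
    · simp
    · rw [smul_smul, one_div_mul_cancel hj.ne', one_smul]
  | succ k ih =>
    rw [innerLoop, Prog.expect_bind]
    have h1 := expect_innerStep_le H hP hh snap z st hst
    set T := (1 - P.ω) * (objective f h snap - objective f h z)
    have h2 := Prog.expect_mul_add (O := gradOracle f) H.p_sum
      (innerStep P h snap (meanGrad f snap) st) (fun r => (objective f h r.x - objective f h z)
        + P.ω ^ 2 / (2 * P.η) * ‖z - r.y‖ ^ 2) 1
      (j * (objective f h w - objective f h z) + k * T)
    refine (Prog.expect_mono hp0 (post_innerStep P h snap (meanGrad f snap) st)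
      (ψ := fun r => 1 * ((objective f h r.x - objective f h z)
        + P.ω ^ 2 / (2 * P.η) * ‖z - r.y‖ ^ 2) +
        (j * (objective f h w - objective f h z) + k * T)) ?_).trans ?_
    · intro r hr
      have h3 := ih (j := j + 1) (by positivity) ((1 / (j + 1)) • (j • w + r.x)) r hr.1 (by
        rw [hr.2, hw, smul_smul, mul_one_div_cancel (by positivity), one_smul])
      have h4 := convex_average_step (H.convexOn_objective hh) hj w r.x (objective f h z)
      have he : j + ((k + 1 : ℕ) : ℝ) = j + 1 + k := by push_cast; ring
      rw [he]
      linarith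
    · rw [h2]
      push_cast
      linarith

theorem expect_epoch_le (hm : 0 < P.m) (z : Vec d) {st : EpochState d} (hst : st.Inv P) :
    Prog.expect p (gradOracle f) (epoch P h st) (fun st' =>
      (objective f h st'.snap - objective f h z)
        + P.ω ^ 2 / (2 * P.η * P.m) * ‖z - st'.y‖ ^ 2) ≤
    (1 - P.ω) * (objective f h st.snap - objective f h z)
      + P.ω ^ 2 / (2 * P.η * P.m) * ‖z - st.y‖ ^ 2 := by
  have hη := hP.η_pos
  have hm' : (0 : ℝ) < P.m := Nat.cast_pos.2 hm
  have h1 := expect_innerLoop_le H hP hh st.snap z P.m le_rfl 0 ⟨st.x, st.y, 0⟩ hst.2 (by simp)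
  rw [epoch, Prog.expect_bind, expect_fullGrad, Prog.expect_bind, hst.1]
  change Prog.expect p (gradOracle f) (innerLoop P h st.snap (meanGrad f st.snap) P.m _)
    (fun r => (objective f h ((1 / (P.m : ℝ)) • r.xSum) - objective f h z)
      + P.ω ^ 2 / (2 * P.η * P.m) * ‖z - r.y‖ ^ 2) ≤ _
  have h2 := Prog.expect_mul_add (O := gradOracle f) H.p_sum
      (innerLoop P h st.snap (meanGrad f st.snap) P.m ⟨st.x, st.y, 0⟩) (fun r =>
      (0 + (P.m : ℝ)) * (objective f h ((1 / (0 + (P.m : ℝ))) • r.xSum) - objective f h z)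
        + P.ω ^ 2 / (2 * P.η) * ‖z - r.y‖ ^ 2) (1 / P.m) 0
  have he : (fun r : InnerState d => (objective f h ((1 / (P.m : ℝ)) • r.xSum) - objective f h z)
      + P.ω ^ 2 / (2 * P.η * P.m) * ‖z - r.y‖ ^ 2) = fun r => 1 / (P.m : ℝ) *
      ((0 + (P.m : ℝ)) * (objective f h ((1 / (0 + (P.m : ℝ))) • r.xSum) - objective f h z)
        + P.ω ^ 2 / (2 * P.η) * ‖z - r.y‖ ^ 2) + 0 := by
    funext r
    rw [zero_add]
    field_simp
    ring
  rw [he, h2]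
  refine (add_le_add_left (mul_le_mul_of_nonneg_left h1 (by positivity)) 0).trans (le_of_eq ?_)
  field_simp
  ring

/-- Each epoch leaves a full gap on the left and `1 - ω` of the previous one on the right, so a
fraction `ω` of every gap survives the telescoping. Minimality of `z` allows the final gap to be
dropped. -/
theorem expect_epochs_le (hρ : 1 ≤ P.ρ) (hm : 0 < P.m) {z : Vec d}
    (hz : ∀ x, objective f h z ≤ objective f h x) (S : ℕ) {j : ℝ} (hj : 0 ≤ j) (w : Vec d)
    {st : EpochState d} (hst : st.Inv P) (hw : st.snapSum = j • w) :
    Prog.expect p (gradOracle f) (epochs P h S st) (fun r =>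
      P.ω * ((j + S) * (objective f h ((1 / (j + S)) • r.snapSum) - objective f h z))) ≤
    P.ω * (j * (objective f h w - objective f h z))
      + (1 - P.ω) * (objective f h st.snap - objective f h z)
      + P.ω ^ 2 / (2 * P.η * P.m) * ‖z - st.y‖ ^ 2 := by
  have hp0 : ∀ i, 0 ≤ p i := fun i => (H.p_pos i).le
  have hη := hP.η_pos
  induction S generalizing j w st with
  | zero =>
    simp only [epochs, Prog.expect_pure, hw, Nat.cast_zero, add_zero]
    have h1 : 0 ≤ (1 - P.ω) * (objective f h st.snap - objective f h z) :=
      mul_nonneg (by linarith [hP.ω_lt]) (by linarith [hz st.snap])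
    have h2 : 0 ≤ P.ω ^ 2 / (2 * P.η * P.m) * ‖z - st.y‖ ^ 2 := by positivity
    rcases hj.eq_or_lt with rfl | hj
    · simp only [zero_mul, mul_zero]
      linarith
    · rw [smul_smul, one_div_mul_cancel hj.ne', one_smul]
      linarith
  | succ S ih =>
    rw [epochs, Prog.expect_bind]
    have h1 := expect_epoch_le H hP hh hm z hst
    have h2 := Prog.expect_mul_add (O := gradOracle f) H.p_sum (epoch P h st)
      (fun r => (objective f h r.snap - objective f h z)
        + P.ω ^ 2 / (2 * P.η * P.m) * ‖z - r.y‖ ^ 2) 1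
      (P.ω * (j * (objective f h w - objective f h z)))
    refine (Prog.expect_mono hp0 (post_epoch hρ h hst)
      (ψ := fun r => 1 * ((objective f h r.snap - objective f h z)
        + P.ω ^ 2 / (2 * P.η * P.m) * ‖z - r.y‖ ^ 2) +
        P.ω * (j * (objective f h w - objective f h z))) ?_).trans ?_
    · intro r hr
      have h3 := ih (j := j + 1) (by positivity) ((1 / (j + 1)) • (j • w + r.snap)) hr.1 (by
        rw [hr.2, hw, smul_smul, mul_one_div_cancel (by positivity), one_smul])
      have h4 := mul_le_mul_of_nonneg_left (convex_average_step (H.convexOn_objective hh) hj w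
        r.snap (objective f h z)) hP.ω_pos.le
      -- The gap at `r.snap` occurs with weight `ω` from the average and `1 - ω` from the induction
      -- hypothesis: in total once, as `expect_epoch_le` requires.
      have he : j + ((S + 1 : ℕ) : ℝ) = j + 1 + S := by push_cast; ring
      rw [he]
      linarith
    · rw [h2]
      linarith

/-- A run of `S` epochs from `x` contracts the expected gap at the average of the snapshots. -/
theorem expect_asvrg_le (hρ : 1 ≤ P.ρ) (hm : 0 < P.m) (hm₁ : P.m₁ = P.m) {z : Vec d} {σ : ℝ}
    (hσ : 0 < σ)
    (hz : ∀ x, objective f h z + σ / 2 * ‖x - z‖ ^ 2 ≤ objective f h x) {S : ℕ} (hS : 0 < S)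
    (x : Vec d) :
    Prog.expect p (gradOracle f) (asvrg P h S x) (fun r =>
      objective f h ((1 / (S : ℝ)) • r.snapSum) - objective f h z) ≤
    1 / S * ((1 - P.ω) / P.ω + P.ω / (P.η * P.m * σ)) *
      (objective f h x - objective f h z) := by
  have hη := hP.η_pos
  have hω := hP.ω_pos
  have hm' : (0 : ℝ) < P.m := Nat.cast_pos.2 hm
  have hS' : (0 : ℝ) < S := Nat.cast_pos.2 hS
  have hz' : ∀ x, objective f h z ≤ objective f h x := fun x => by
    have : 0 ≤ σ / 2 * ‖x - z‖ ^ 2 := by positivity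
    linarith [hz x]
  have h1 := expect_epochs_le H hP hh hρ hm hz' S le_rfl 0 (inv_initial hm₁ x) (by simp)
  have h2 := Prog.expect_mul_add (O := gradOracle f) H.p_sum (asvrg P h S x) (fun r =>
      P.ω * ((0 + S) * (objective f h ((1 / (0 + S : ℝ)) • r.snapSum) - objective f h z)))
      (1 / (P.ω * S)) 0
  have he : (fun r : EpochState d => objective f h ((1 / (S : ℝ)) • r.snapSum) - objective f h z)
      = fun r => 1 / (P.ω * S) * (P.ω * ((0 + S) *
        (objective f h ((1 / (0 + S : ℝ)) • r.snapSum) - objective f h z))) + 0 := by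
    funext r
    rw [zero_add]
    field_simp
    ring
  rw [he, h2]
  refine (add_le_add_left (mul_le_mul_of_nonneg_left h1 (by positivity)) 0).trans ?_
  dsimp only
  -- Quadratic growth converts the initial distance into the initial gap.
  have h3 : ‖z - x‖ ^ 2 ≤ 2 / σ * (objective f h x - objective f h z) := by
    rw [norm_sub_rev, div_mul_eq_mul_div, le_div_iff₀ hσ]
    linarith [hz x]
  calc _ = 1 / (P.ω * S) * ((1 - P.ω) * (objective f h x - objective f h z)
        + P.ω ^ 2 / (2 * P.η * P.m) * ‖z - x‖ ^ 2) := by ring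
    _ ≤ 1 / (P.ω * S) * ((1 - P.ω) * (objective f h x - objective f h z)
        + P.ω ^ 2 / (2 * P.η * P.m) * (2 / σ * (objective f h x - objective f h z))) := by
        gcongr
    _ = _ := by field_simp

theorem expect_restartedAsvrg_le (hρ : 1 ≤ P.ρ) (hm : 0 < P.m) (hm₁ : P.m₁ = P.m) {z : Vec d}
    {σ : ℝ} (hσ : 0 < σ)
    (hz : ∀ x, objective f h z + σ / 2 * ‖x - z‖ ^ 2 ≤ objective f h x) (R : ℕ) (x : Vec d) :
    Prog.expect p (gradOracle f) (restartedAsvrg P h (restartPeriod P.η P.ω P.m σ) R x)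
      (fun r => objective f h r - objective f h z) ≤
    (1 / 2) ^ R * (objective f h x - objective f h z) := by
  have hη := hP.η_pos
  have hω := hP.ω_pos
  have hω1 : 0 < 1 - P.ω := by linarith [hP.ω_lt]
  have hm' : (0 : ℝ) < P.m := Nat.cast_pos.2 hm
  have hq : 0 < 2 * ((1 - P.ω) / P.ω + P.ω / (P.η * P.m * σ)) := by positivity
  set S := restartPeriod P.η P.ω P.m σ with hSdef
  have hS : 0 < S := Nat.ceil_pos.2 hq
  have hS' : (0 : ℝ) < S := Nat.cast_pos.2 hS
  have hle : 2 * ((1 - P.ω) / P.ω + P.ω / (P.η * P.m * σ)) ≤ S := Nat.le_ceil _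
  induction R generalizing x with
  | zero => simp [restartedAsvrg]
  | succ R ih =>
    rw [restartedAsvrg, Prog.expect_bind]
    have h1 := expect_asvrg_le H hP hh hρ hm hm₁ hσ hz hS x
    have h2 := Prog.expect_mul_add (O := gradOracle f) H.p_sum (asvrg P h S x) (fun r =>
      objective f h ((1 / (S : ℝ)) • r.snapSum) - objective f h z) ((1 / 2) ^ R) 0
    refine (Prog.expect_mono (fun i => (H.p_pos i).le) (Prog.post_true _) (fun r _ =>
      (ih ((1 / (S : ℝ)) • r.snapSum)).trans_eq (add_zero _).symm)).trans ?_
    rw [h2, add_zero, pow_succ, mul_assoc]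
    refine mul_le_mul_of_nonneg_left (h1.trans ?_) (by positivity)
    have hx : 0 ≤ objective f h x - objective f h z := by
      have : 0 ≤ σ / 2 * ‖x - z‖ ^ 2 := by positivity
      linarith [hz x]
    refine mul_le_mul_of_nonneg_right ?_ hx
    rw [one_div_mul_eq_div, div_le_div_iff₀ hS' two_pos]
    linarith

end Loops

/-! ### The base method -/

section BaseMethod

variable {n d : ℕ}

/-- For `η = 1/(3L̃)` the condition reads `ω ≤ 1/2`, which is what the threshold `3/4` yields; for
`ω = 1/2`, `η = 1/(4mσ)` it reads `mσ ≥ 3L̃/4`, the complementary regime. -/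
theorem admissible_baseMethod {Lt σ : ℝ} (hL : 0 < Lt) (hσ : 0 < σ) {m : ℕ} (hm : 0 < m) (ρ : ℝ)
    (p : Fin n → ℝ) :
    (⟨stepSize Lt m σ, momentum Lt m σ, m, ρ, m, p⟩ : Params n).Admissible Lt p := by
  have hm' : (0 : ℝ) < m := Nat.cast_pos.2 hm
  by_cases hc : m * σ / Lt ≤ 3 / 4
  · have hω : √(m * σ / (3 * Lt)) ≤ 1 / 2 := by
      rw [Real.sqrt_le_left (by norm_num)]
      calc m * σ / (3 * Lt) = m * σ / Lt / 3 := by field_simp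
        _ ≤ 3 / 4 / 3 := by gcongr
        _ = _ := by norm_num
    refine ⟨rfl, ?_, ?_, ?_, ?_⟩ <;> simp only [stepSize, momentum, if_pos hc]
    · positivity
    · positivity
    · linarith
    · rw [one_div_one_div]
      nlinarith
  · refine ⟨rfl, ?_, ?_, ?_, ?_⟩ <;> simp only [stepSize, momentum, if_neg hc]
    · positivity
    · norm_num
    · norm_num
    · rw [not_le, lt_div_iff₀ hL] at hc
      rw [one_div_one_div]
      linarith

/-- In the first regime `ηmσ = ω²`, so the quantity rounded up is `4/ω - 2`; in the second it is
exactly `6`. -/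
theorem restartPeriod_le {Lt σ : ℝ} (hL : 0 < Lt) (hσ : 0 < σ) {m : ℕ} (hm : 0 < m) :
    (restartPeriod (stepSize Lt m σ) (momentum Lt m σ) m σ : ℝ) ≤
      6 + 4 * √(3 * Lt / (m * σ)) := by
  have hm' : (0 : ℝ) < m := Nat.cast_pos.2 hm
  by_cases hc : m * σ / Lt ≤ 3 / 4
  · simp only [restartPeriod, stepSize, momentum, if_pos hc]
    have hω0 : 0 < √(m * σ / (3 * Lt)) := by positivity
    have hsq : √(m * σ / (3 * Lt)) ^ 2 = m * σ / (3 * Lt) := Real.sq_sqrt (by positivity)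
    have hinv : √(3 * Lt / (m * σ)) = (√(m * σ / (3 * Lt)))⁻¹ := by
      rw [← Real.sqrt_inv, inv_div]
    have hω1 : √(m * σ / (3 * Lt)) ≤ 1 := by
      rw [Real.sqrt_le_left zero_le_one, one_pow]
      calc m * σ / (3 * Lt) = m * σ / Lt / 3 := by field_simp
        _ ≤ 3 / 4 / 3 := by gcongr
        _ ≤ _ := by norm_num
    set w := √(m * σ / (3 * Lt))
    have h1 : 1 / (3 * Lt) * m * σ = w ^ 2 := by
      rw [hsq]
      field_simp
    rw [h1]
    have h2 : 2 * ((1 - w) / w + w / w ^ 2) = 4 * w⁻¹ - 2 := by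
      field_simp
      ring
    have h3 : 1 ≤ w⁻¹ := (one_le_inv₀ hω0).2 hω1
    rw [h2, hinv]
    have := Nat.ceil_lt_add_one (a := 4 * w⁻¹ - 2) (by linarith)
    linarith
  · simp only [restartPeriod, stepSize, momentum, if_neg hc]
    have h2 : 2 * ((1 - 1 / 2) / (1 / 2) + 1 / 2 / (1 / (4 * m * σ) * m * σ)) = ((6 : ℕ) : ℝ) := by
      push_cast
      field_simp
      norm_num
    rw [h2, Nat.ceil_natCast]
    push_cast
    linarith [Real.sqrt_nonneg (3 * Lt / (m * σ))]

theorem calls_baseMethod_le {O : Fin n → Vec d → Vec d} {L p : Fin n → ℝ}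
    (hL : 0 < weightedL L p) {m : ℕ} (hm : 0 < m) {ρ : ℝ} (hρ : 1 ≤ ρ) (h : Vec d → ℝ) {σ : ℝ}
    (hσ : 0 < σ) (x : Vec d) :
    (Prog.calls O (baseMethod L p m ρ h σ x) : ℝ) ≤
      2 * (n + 2 * m) * (6 + 4 * √(3 * weightedL L p / (m * σ))) := by
  have h1 : (Prog.calls O (baseMethod L p m ρ h σ x) : ℝ) ≤
      ((2 * (restartPeriod (stepSize (weightedL L p) m σ) (momentum (weightedL L p) m σ) m σ
        * (n + 2 * m)) : ℕ) : ℝ) :=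
    Nat.cast_le.2 (calls_restartedAsvrg_le (P := ⟨_, _, m, ρ, m, p⟩) hρ rfl h _ 2 x)
  refine h1.trans ?_
  push_cast
  have h2 := restartPeriod_le hL hσ hm
  have h3 : (0 : ℝ) ≤ 2 * (n + 2 * m) := by positivity
  linarith [mul_le_mul_of_nonneg_left h2 h3]

theorem convexOn_add_sq {g : Vec d → ℝ} (hg : ConvexOn ℝ Set.univ g) {σ : ℝ} (hσ : 0 ≤ σ)
    (x₀ : Vec d) : ConvexOn ℝ Set.univ (fun z => g z + σ / 2 * ‖z - x₀‖ ^ 2) := by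
  refine hg.add ?_
  have h1 : ConvexOn ℝ Set.univ (fun z : Vec d => ‖z - x₀‖) := by
    simpa [Function.comp_def, sub_eq_add_neg] using
      (convexOn_univ_norm (E := Vec d)).translate_left (-x₀)
  exact (h1.pow (fun _ _ => norm_nonneg _) 2).smul (by positivity)

theorem objective_add (f : Fin n → Vec d → ℝ) (g r : Vec d → ℝ) (x : Vec d) :
    objective f (fun z => g z + r z) x = objective f g x + r x := by
  simp only [objective]
  ring

/-- The base method contracts the gap of the regularized objective by the factor `1/4`. -/
theorem expect_baseMethod_le {f : Fin n → Vec d → ℝ} {L p : Fin n → ℝ}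
    (H : SmoothFiniteSum f L p) {g : Vec d → ℝ} (hg : ConvexOn ℝ Set.univ g) {m : ℕ}
    (hm : 0 < m) {ρ : ℝ} (hρ : 1 ≤ ρ) {σ : ℝ} (hσ : 0 < σ) {x₀ z : Vec d}
    (hz : ∀ x, objective f g z + σ / 2 * ‖z - x₀‖ ^ 2 ≤
      objective f g x + σ / 2 * ‖x - x₀‖ ^ 2) (x : Vec d) :
    Prog.expect p (gradOracle f)
      (baseMethod L p m ρ (fun y => g y + σ / 2 * ‖y - x₀‖ ^ 2) σ x) (fun r =>
        (objective f g r + σ / 2 * ‖r - x₀‖ ^ 2) - (objective f g z + σ / 2 * ‖z - x₀‖ ^ 2)) ≤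
    1 / 4 * ((objective f g x + σ / 2 * ‖x - x₀‖ ^ 2) -
      (objective f g z + σ / 2 * ‖z - x₀‖ ^ 2)) := by
  have h1 := expect_restartedAsvrg_le H (admissible_baseMethod H.weightedL_pos hσ hm ρ p)
    (convexOn_add_sq hg hσ.le x₀) hρ hm rfl (z := z) hσ (fun y => by
      -- The three-point inequality supplies the `σ`-quadratic growth of the regularized objective
      -- at its minimizer.
      have := three_point (H.convexOn_objective hg) hz y
      simp only [objective_add]
      linarith) 2 x
  simp only [objective_add] at h1
  refine h1.trans_eq ?_
  norm_num

end BaseMethod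

/-! ### Adaptive regularization -/

section AdaptReg

variable {n d : ℕ}

/-- The coefficient `c_T` of `σ ‖x₀ - xs‖²` solves `c_0 = 1/2`, `c_{T+1} = c_T / 2 + (1/4)^{T+1}`:
the final bias, plus the drift of each stage contracted by the later ones. -/
theorem expect_adaptReg_le {f : Fin n → Vec d → ℝ} {p : Fin n → ℝ}
    (hp0 : ∀ i, 0 ≤ p i) (hp : ∑ i, p i = 1) {g : Vec d → ℝ}
    (hF : ConvexOn ℝ Set.univ (objective f g))
    {A : (Vec d → ℝ) → ℝ → Vec d → Prog n (Vec d) (Vec d)} {x₀ xs : Vec d}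
    (hA : ∀ σ z x, 0 < σ → (∀ x, objective f g z + σ / 2 * ‖z - x₀‖ ^ 2 ≤
        objective f g x + σ / 2 * ‖x - x₀‖ ^ 2) →
      Prog.expect p (gradOracle f) (A (fun y => g y + σ / 2 * ‖y - x₀‖ ^ 2) σ x) (fun r =>
        (objective f g r + σ / 2 * ‖r - x₀‖ ^ 2) - (objective f g z + σ / 2 * ‖z - x₀‖ ^ 2)) ≤
      1 / 4 * ((objective f g x + σ / 2 * ‖x - x₀‖ ^ 2) -
        (objective f g z + σ / 2 * ‖z - x₀‖ ^ 2)))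
    (hxs : ∀ x, objective f g xs ≤ objective f g x) (T : ℕ) {σ : ℝ} (hσ : 0 < σ) {z : Vec d}
    (hz : ∀ x, objective f g z + σ / 2 * ‖z - x₀‖ ^ 2 ≤
      objective f g x + σ / 2 * ‖x - x₀‖ ^ 2) (x : Vec d) :
    Prog.expect p (gradOracle f) (adaptReg A g x₀ T σ x)
      (fun r => objective f g r - objective f g xs) ≤
    (1 / 4) ^ T * ((objective f g x + σ / 2 * ‖x - x₀‖ ^ 2) -
      (objective f g z + σ / 2 * ‖z - x₀‖ ^ 2)) +
      (3 / 2 * (1 / 2) ^ T - (1 / 4) ^ T) * (σ * ‖x₀ - xs‖ ^ 2) := by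
  set D := ‖x₀ - xs‖ with hD
  induction T generalizing σ z x with
  | zero =>
    have h1 := hz xs
    rw [norm_sub_rev xs x₀, ← hD] at h1
    have h2 : 0 ≤ σ / 2 * ‖x - x₀‖ ^ 2 := by positivity
    simp only [adaptReg, Prog.expect_pure, pow_zero]
    linarith
  | succ T ih =>
    have hσ2 : 0 < σ / 2 := by positivity
    obtain ⟨w, hw⟩ := exists_isMin_add_sq hF hσ2 x₀
    rw [adaptReg, Prog.expect_bind]
    have h1 := Prog.expect_mul_add (O := gradOracle f) hp
      (A (fun y => g y + σ / 2 * ‖y - x₀‖ ^ 2) σ x) (fun r =>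
        (objective f g r + σ / 2 * ‖r - x₀‖ ^ 2) - (objective f g z + σ / 2 * ‖z - x₀‖ ^ 2))
      ((1 / 4) ^ T) ((1 / 4) ^ T * (σ / 4 * D ^ 2) +
        (3 / 2 * (1 / 2) ^ T - (1 / 4) ^ T) * (σ / 2 * D ^ 2))
    -- A regularized minimizer is no farther from the centre than `xs`, so the drift is bounded
    -- independently of the iterates.
    have hwD : σ / 2 / 2 * ‖w - x₀‖ ^ 2 ≤ σ / 4 * D ^ 2 := by
      have h2 := hw xs
      have h3 := hxs w
      rw [norm_sub_rev xs x₀, ← hD] at h2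
      linarith
    refine (Prog.expect_mono hp0 (Prog.post_true _) (fun r _ => ?_)).trans
      (h1.trans_le ?_)
    · refine (ih hσ2 hw r).trans ?_
      have h4 : (objective f g r + σ / 2 / 2 * ‖r - x₀‖ ^ 2) -
          (objective f g w + σ / 2 / 2 * ‖w - x₀‖ ^ 2) ≤
          (objective f g r + σ / 2 * ‖r - x₀‖ ^ 2) -
          (objective f g z + σ / 2 * ‖z - x₀‖ ^ 2) + σ / 4 * D ^ 2 := by
        have h5 := hz w
        have h6 : 0 ≤ σ / 2 * ‖r - x₀‖ ^ 2 := by positivity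
        linarith
      have h7 := mul_le_mul_of_nonneg_left h4 (show (0 : ℝ) ≤ (1 / 4) ^ T by positivity)
      linarith
    · have h8 := mul_le_mul_of_nonneg_left (hA σ z x hσ hz)
        (show (0 : ℝ) ≤ (1 / 4) ^ T by positivity)
      rw [pow_succ (1 / 4 : ℝ), pow_succ (1 / 2 : ℝ)]
      linarith

theorem calls_adaptReg_le {O : Fin n → Vec d → Vec d}
    {A : (Vec d → ℝ) → ℝ → Vec d → Prog n (Vec d) (Vec d)} {N K : ℝ} (hN : 0 ≤ N)
    (hA : ∀ h σ x, 0 < σ → (Prog.calls O (A h σ x) : ℝ) ≤ N * (6 + 4 * √(K / σ)))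
    (g : Vec d → ℝ) (x₀ : Vec d) (T : ℕ) {σ : ℝ} (hσ : 0 < σ) (x : Vec d) :
    (Prog.calls O (adaptReg A g x₀ T σ x) : ℝ) ≤
      N * (6 * T + 12 * (√2 ^ T - 1) * √(K / σ)) := by
  induction T generalizing σ x with
  | zero => simp [adaptReg, Prog.calls, pure]
  | succ T ih =>
    have h1 : (Prog.calls O (adaptReg A g x₀ (T + 1) σ x) : ℝ) ≤
        N * (6 + 4 * √(K / σ)) + N * (6 * T + 12 * (√2 ^ T - 1) * √(K / (σ / 2))) := by
      have h2 : ∀ x', Prog.calls O (adaptReg A g x₀ T (σ / 2) x') ≤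
          ⌊N * (6 * T + 12 * (√2 ^ T - 1) * √(K / (σ / 2)))⌋₊ := fun x' =>
        Nat.le_floor (ih (by positivity) x')
      have h3 := Prog.calls_bind_le
        (Prog.post_true (O := O) (A (fun z => g z + σ / 2 * ‖z - x₀‖ ^ 2) σ x))
        (fun x' _ => h2 x')
      have h4 : (Prog.calls O (adaptReg A g x₀ (T + 1) σ x) : ℝ) ≤ _ := Nat.cast_le.2 h3
      refine h4.trans ?_
      rw [Nat.cast_add]
      refine add_le_add (hA _ _ _ hσ) (Nat.floor_le ?_)
      exact (Nat.cast_nonneg _).trans (ih (by positivity) x)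
    have h5 : √(K / (σ / 2)) = √2 * √(K / σ) := by
      rw [← Real.sqrt_mul zero_le_two]
      congr 1
      field_simp
    -- Halving `σ` multiplies the root by `√2`; the constant `12` closes the geometric induction
    -- precisely because `4 + 12 ≤ 12 √2`.
    have h6 : 4 / 3 ≤ √2 := Real.le_sqrt_of_sq_le (by norm_num)
    refine h1.trans ?_
    rw [h5, ← mul_add]
    refine mul_le_mul_of_nonneg_left ?_ hN
    push_cast
    rw [pow_succ]
    have h7 := mul_le_mul_of_nonneg_right h6 (Real.sqrt_nonneg (K / σ))
    linarith

end AdaptReg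

/-! ### Accuracy and query count of the complete method -/

section Main

variable {n d : ℕ} {f : Fin n → Vec d → ℝ} {L p : Fin n → ℝ} (H : SmoothFiniteSum f L p)
  {g : Vec d → ℝ} {m : ℕ} (hm : 0 < m) {ρ : ℝ} (hρ : 1 ≤ ρ) {x₀ xs : Vec d}
  (hxs : ∀ x, objective f g xs ≤ objective f g x) {ε : ℝ} (hε : 0 < ε)
include hxs

/-- A positive gap forces `x₀ ≠ xs`, so `σ₀` is well defined and positive; a zero gap gives no
stages. -/
theorem eq_initial_or_gap_pos :
    (objective f g x₀ - objective f g xs = 0) ∨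
      (0 < objective f g x₀ - objective f g xs ∧ 0 < ‖x₀ - xs‖) := by
  rcases (sub_nonneg.2 (hxs x₀)).eq_or_lt with h | h
  · exact Or.inl h.symm
  · refine Or.inr ⟨h, norm_pos_iff.2 fun h0 => ?_⟩
    rw [sub_eq_zero.1 h0, sub_self] at h
    exact h.false

include H hm hρ hε

/-- The expected gap of the output is at most `ε`. -/
theorem expect_adaptRegAsvrg_le (hg : ConvexOn ℝ Set.univ g) :
    Prog.expect p (gradOracle f) (adaptRegAsvrg L p m ρ g x₀
      (objective f g x₀ - objective f g xs) ‖x₀ - xs‖ ε) (objective f g) - objective f g xs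
      ≤ ε := by
  have hF := H.convexOn_objective hg
  rw [adaptRegAsvrg]
  set Δ := objective f g x₀ - objective f g xs with hΔ
  rcases eq_initial_or_gap_pos (f := f) (x₀ := x₀) hxs with h0 | ⟨hΔ0, hD⟩
  · rw [← hΔ] at h0
    -- The convention `logb 2 0 = 0` makes the number of stages zero.
    simp only [h0, mul_zero, zero_div, Real.logb_zero, Nat.ceil_zero, adaptReg, Prog.expect_pure]
    rw [← hΔ, h0]
    exact hε.le
  · rw [← hΔ] at hΔ0
    set T := ⌈Real.logb 2 (2 * Δ / ε)⌉₊ with hT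
    have hσ : 0 < Δ / ‖x₀ - xs‖ ^ 2 := by positivity
    have hpow : 2 * Δ / ε ≤ 2 ^ T := by
      rw [← Real.rpow_natCast, ← Real.logb_le_iff_le_rpow one_lt_two (by positivity)]
      exact Nat.le_ceil _
    obtain ⟨z, hz⟩ := exists_isMin_add_sq hF hσ x₀
    have h1 := expect_adaptReg_le (fun i => (H.p_pos i).le) H.p_sum hF
      (A := baseMethod L p m ρ) (fun σ z x hσ hz => expect_baseMethod_le H hg hm hρ hσ hz x)
      hxs T hσ hz x₀
    have h2 := Prog.expect_mul_add (O := gradOracle f) H.p_sum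
      (adaptReg (baseMethod L p m ρ) g x₀ T (Δ / ‖x₀ - xs‖ ^ 2) x₀) (objective f g) 1
      (-objective f g xs)
    simp only [one_mul, ← sub_eq_add_neg] at h2
    rw [h2, div_mul_cancel₀ _ (by positivity), sub_self, norm_zero] at h1
    have h3 : (objective f g x₀ + Δ / ‖x₀ - xs‖ ^ 2 / 2 * (0 : ℝ) ^ 2) -
        (objective f g z + Δ / ‖x₀ - xs‖ ^ 2 / 2 * ‖z - x₀‖ ^ 2) ≤ Δ := by
      have h4 : 0 ≤ Δ / ‖x₀ - xs‖ ^ 2 / 2 * ‖z - x₀‖ ^ 2 := by positivity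
      rw [hΔ] at h4 ⊢
      linarith [hxs z]
    have h5 := mul_le_mul_of_nonneg_left h3 (show (0 : ℝ) ≤ (1 / 4) ^ T by positivity)
    -- As `σ₀ ‖x₀ - xs‖² = Δ` and the initial regularized gap is at most `Δ`, the `4^{-T}` terms
    -- cancel and `3/2 · 2^{-T} Δ ≤ 3ε/4` remains.
    have h6 : (1 / 2 : ℝ) ^ T * Δ ≤ ε / 2 := by
      rw [one_div, inv_pow, inv_mul_le_iff₀ (by positivity)]
      rw [div_le_iff₀ hε] at hpow
      linarith
    linarith

/-- The number of queries of the method in terms of `m` and `n`. -/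
theorem calls_adaptRegAsvrg_le {O : Fin n → Vec d → Vec d} :
    (Prog.calls O (adaptRegAsvrg L p m ρ g x₀
      (objective f g x₀ - objective f g xs) ‖x₀ - xs‖ ε) : ℝ) ≤
    2 * (n + 2 * m) * (24 * max 1 (Real.log ((objective f g x₀ - objective f g xs) / ε))
      + 12 * (√(12 * weightedL L p / m) * ‖x₀ - xs‖ / √ε)) := by
  have hL := H.weightedL_pos
  have hm' : (0 : ℝ) < m := Nat.cast_pos.2 hm
  rw [adaptRegAsvrg]
  set Δ := objective f g x₀ - objective f g xs with hΔ
  set D := ‖x₀ - xs‖ with hD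
  set T := ⌈Real.logb 2 (2 * Δ / ε)⌉₊ with hT
  set M := max 1 (Real.log (Δ / ε)) with hM
  have hM1 : 1 ≤ M := le_max_left _ _
  rcases Nat.eq_zero_or_pos T with h0 | hTpos
  · rw [h0]
    simp only [adaptReg, Prog.calls, pure, Nat.cast_zero]
    positivity
  · rcases eq_initial_or_gap_pos (f := f) (x₀ := x₀) hxs with h0 | ⟨hΔ0, hD0⟩
    · rw [← hΔ] at h0
      simp [hT, h0] at hTpos
    · rw [← hΔ] at hΔ0
      rw [← hD] at hD0
      have hσ : 0 < Δ / D ^ 2 := by positivity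
      have hlog : 0 < Real.logb 2 (2 * Δ / ε) := Nat.ceil_pos.1 hTpos
      have hTlt : (T : ℝ) < Real.logb 2 (2 * Δ / ε) + 1 := Nat.ceil_lt_add_one hlog.le
      have hlog2 : Real.logb 2 (2 * Δ / ε) = 1 + Real.log (Δ / ε) / Real.log 2 := by
        rw [mul_div_assoc, Real.logb_mul two_ne_zero (by positivity), Real.logb_self_eq_one
          one_lt_two, Real.log_div_log]
      -- `T < 2 + log(Δ/ε)/log 2`, with `log 2 > 1/2` and `M ≥ 1`.
      have hTM : (T : ℝ) ≤ 4 * M := by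
        have h1 : Real.log (Δ / ε) / Real.log 2 ≤ 2 * M := by
          have h2 := Real.log_two_gt_d9
          rw [div_le_iff₀ (by linarith)]
          have h3 : Real.log (Δ / ε) ≤ M := le_max_right _ _
          nlinarith
        linarith
      have hpow : (2 : ℝ) ^ T ≤ 4 * Δ / ε := by
        have h1 : (2 : ℝ) ^ ((T : ℝ) - 1) < 2 * Δ / ε := by
          rw [← Real.lt_logb_iff_rpow_lt one_lt_two (by positivity)]
          linarith
        rw [Real.rpow_sub_one two_ne_zero, Real.rpow_natCast, div_lt_iff₀ two_pos] at h1
        refine h1.le.trans_eq ?_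
        ring
      -- Here `Δ` cancels between `2^T ≤ 4Δ/ε` and `σ₀ = Δ/D²`, leaving the distance alone.
      have hsqrt : √2 ^ T * √(3 * weightedL L p / m / (Δ / D ^ 2)) ≤
          √(12 * weightedL L p / m) * D / √ε := by
        calc √2 ^ T * √(3 * weightedL L p / m / (Δ / D ^ 2))
            = √(2 ^ T * (3 * weightedL L p / m / (Δ / D ^ 2))) := by
              rw [Real.sqrt_mul (by positivity)]
              congr 1
              rw [← Real.sqrt_sq (show 0 ≤ √2 ^ T by positivity), ← pow_mul, mul_comm T 2, pow_mul,
                Real.sq_sqrt zero_le_two]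
          _ ≤ √(4 * Δ / ε * (3 * weightedL L p / m / (Δ / D ^ 2))) := by gcongr
          _ = √(12 * weightedL L p / m * D ^ 2 / ε) := by
              congr 1
              field_simp
              ring
          _ = _ := by
              rw [Real.sqrt_div (by positivity), Real.sqrt_mul (by positivity),
                Real.sqrt_sq hD0.le]
      have h1 := calls_adaptReg_le (O := O) (A := baseMethod L p m ρ) (N := 2 * (n + 2 * m))
        (K := 3 * weightedL L p / m) (by positivity) (fun h σ x hσ => by
          rw [div_div]
          exact calls_baseMethod_le hL hm hρ h hσ x) g x₀ T hσ x₀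
      refine h1.trans (mul_le_mul_of_nonneg_left ?_ (by positivity))
      have h2 := Real.sqrt_nonneg (3 * weightedL L p / m / (Δ / D ^ 2))
      linarith

end Main

end ASVRG

theorem mainTheorem8 (a b : ℝ) (ha : 0 < a) (hab : a ≤ b) :
    ∃ C : ℝ, 0 < C ∧
      ∀ (n d : ℕ) (f : Fin n → ASVRG.Vec d → ℝ) (L p : Fin n → ℝ) (g : ASVRG.Vec d → ℝ)
        (x₀ xs : ASVRG.Vec d) (m : ℕ) (ρ ε : ℝ),
        0 < n →
        (∀ i, ConvexOn ℝ Set.univ (f i)) →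
        (∀ i, Differentiable ℝ (f i)) →
        (∀ i, 0 < L i) →
        (∀ i x y, ‖gradient (f i) x - gradient (f i) y‖ ≤ L i * ‖x - y‖) →
        ConvexOn ℝ Set.univ g →
        (∀ i, 0 < p i) →
        ∑ i, p i = 1 →
        (∀ x, ASVRG.objective f g xs ≤ ASVRG.objective f g x) →
        a * n ≤ m →
        (m : ℝ) ≤ b * n →
        1 ≤ ρ →
        0 < ε →
        let F := ASVRG.objective f g
        let alg := ASVRG.adaptRegAsvrg L p m ρ g x₀ (F x₀ - F xs) ‖x₀ - xs‖ ε
        alg.expect p (ASVRG.gradOracle f) F - F xs ≤ ε ∧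
        (alg.calls (ASVRG.gradOracle f) : ℝ) ≤
          C * (n * max 1 (Real.log ((F x₀ - F xs) / ε)) +
            √(n * ASVRG.weightedL L p) * ‖x₀ - xs‖ / √ε) := by
  have hb : 0 < b := ha.trans_le hab
  -- The upper bound on `m` controls the epoch cost `n + 2m`; the lower bound turns `n √(12 L̃/m)`
  -- into `√(12/a) √(n L̃)`.
  refine ⟨2 * (1 + 2 * b) * (24 + 12 * √(12 / a)), by positivity, ?_⟩
  intro n d f L p g x₀ xs m ρ ε hn hf hd hL hlip hg hp hsum hxs hma hmb hρ hε F alg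
  have H : ASVRG.SmoothFiniteSum f L p := ⟨hn, hf, hd, hL, hlip, hp, hsum⟩
  have hn' : (0 : ℝ) < n := Nat.cast_pos.2 hn
  have hm' : (0 : ℝ) < m := (mul_pos ha hn').trans_le hma
  have hm : 0 < m := Nat.cast_pos.1 hm'
  refine ⟨ASVRG.expect_adaptRegAsvrg_le H hm hρ hxs hε hg,
    (ASVRG.calls_adaptRegAsvrg_le H hm hρ hxs hε).trans ?_⟩
  have hLt := H.weightedL_pos
  set M := max 1 (Real.log ((F x₀ - F xs) / ε))
  set Q := √(n * ASVRG.weightedL L p) * ‖x₀ - xs‖ / √ε with hQ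
  have hM : 1 ≤ M := le_max_left _ _
  have hQ0 : 0 ≤ Q := by positivity
  have hnm : (n : ℝ) + 2 * m ≤ (1 + 2 * b) * n := by linarith
  have hs : n * (√(12 * ASVRG.weightedL L p / m) * ‖x₀ - xs‖ / √ε) ≤ √(12 / a) * Q := by
    have h1 : n * √(12 * ASVRG.weightedL L p / m) ≤ √(12 / a) * √(n * ASVRG.weightedL L p) := by
      calc n * √(12 * ASVRG.weightedL L p / m)
          ≤ n * √(12 * ASVRG.weightedL L p / (a * n)) := by gcongr
        _ = √(n ^ 2 * (12 * ASVRG.weightedL L p / (a * n))) := by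
            rw [Real.sqrt_mul (by positivity), Real.sqrt_sq hn'.le]
        _ = √(12 / a * (n * ASVRG.weightedL L p)) := by
            congr 1
            field_simp
        _ = _ := Real.sqrt_mul (by positivity) _
    calc n * (√(12 * ASVRG.weightedL L p / m) * ‖x₀ - xs‖ / √ε)
        = n * √(12 * ASVRG.weightedL L p / m) * ‖x₀ - xs‖ / √ε := by ring
      _ ≤ √(12 / a) * √(n * ASVRG.weightedL L p) * ‖x₀ - xs‖ / √ε := by gcongr
      _ = _ := by rw [hQ]; ring
  set R := √(12 * ASVRG.weightedL L p / m) * ‖x₀ - xs‖ / √ε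
  calc 2 * (n + 2 * m) * (24 * M + 12 * R)
      ≤ 2 * ((1 + 2 * b) * n) * (24 * M + 12 * R) := by gcongr
    _ = 2 * (1 + 2 * b) * (24 * (n * M) + 12 * (n * R)) := by ring
    _ ≤ 2 * (1 + 2 * b) * (24 * (n * M) + 12 * (√(12 / a) * Q)) := by gcongr
    _ ≤ 2 * (1 + 2 * b) * ((24 + 12 * √(12 / a)) * (n * M + Q)) := by
        gcongr
        have h1 : 0 ≤ √(12 / a) * (n * M) := by positivity
        linarith
    _ = _ := by ring
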